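/- **Setting.** There are $N=2$ sources. At each time $t=0,1,2,\dots$ source $i\in\{1,2\}$ produces a message $W_{i,t}$, uniform on $\{0,1\}^L$, and all messages are mutually independent. A user requests the messages $W_{X_t,t}$, where $(X_t)$ is a Markov chain on $\{1,2\}$ with initial distribution $\pi_0$ and transition matrix $$P=\begin{pmatrix}1-\alpha&\alpha\\ \beta&1-\beta\end{pmatrix},\qquad 0\le\alpha,\beta\le 1 .$$ The privacy statuses $F_t\in\{\mathrm{ON},\mathrm{OFF}\}$ form a random process that is independent of $(X_t)$, has $F_0=\mathrm{ON}$, and is revealed causally to the user and the server. Write $[t]=\{0,\dots,t\}$, $\mathcal B_t=\{i\le t: F_i=\mathrm{ON}\}$ and $\tau=\tau(t)=\max\mathcal B_t$. A *code* with message length $L\ge 1$ consists of: local randomness $S_t$, generated according to a conditional law given $X_{[t]},F_{[t]},S_{[t-1]}$; queries $Q_t=\rho_t(X_{[t]},F_{[t]},S_{[t]})$ in a countable alphabet $\mathcal Q$; a length function $\ell:\mathcal Q\to\{0,\dots,2L\}$; answers $A_t=\phi_t(Q_t,W_{1,t},W_{2,t})\in\{0,1\}^{\ell(Q_t)}$;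 and decoders $\hat W_t=\psi_t(A_t,X_t,S_t)$. The messages are independent of $(X_t,F_t,S_t)_t$. For every $t$ and every status history $F_{[t]}=f_{[t]}$ of positive probability, the code must satisfy, conditionally on that history, - (decodability) $\Pr(\hat W_t\ne W_{X_t,t})=0$, - (privacy) $I(X_{\mathcal B_t};Q_t\mid Q_{[t-1]})=0$. A tuple of positive rates $(R_t)_{t\ge 0}$, where $R_t$ may depend on the history $f_{[t]}$, is *achievable* if there is one code with $R_t\le L/\ell_t$ for all $t$ and all histories $f_{[t]}$ of positive probability, where $\ell_t=\mathbb E[\ell(Q_t)\mid F_{[t]}=f_{[t]}]$. **Theorem (optimality for $N=2$).** Assume that $\pi_0$ gives positive probability to both states, that $(\alpha,\beta)\notin\{(1,0),(0,1)\}$, and that, if with positive probability the privacy status switches from OFF to ON at some time, then either $0<\alpha,\beta<1$ or $\alpha=\beta=0$ or $\alpha=\beta=1$. Then $(R_t)_{t\ge 0}$ is achievable if and only if $$\frac1{R_t}\ \ge\ 1+|1-\alpha-\beta|^{\,t-\tau}$$ for all $t$ and all status histories up to time $t$ of positive probability (with $0^0=1$). The "if" direction holds for all $0\le\alpha,\beta\le1$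 and all $\pi_0$. -/

import Mathlib

open MeasureTheory ProbabilityTheory
open scoped ENNReal

namespace OnOffPrivacy

/-- The privacy status at a given time. -/
abbrev Status : Type := Bool

/-- Privacy is ON. -/
abbrev ON : Status := true

/-- Privacy is OFF. -/
abbrev OFF : Status := false

/-- The part `x_[i] = (x_0, …, x_i)` of a tuple `x_[t] = (x_0, …, x_t)`. -/
def upTo {A : Type*} {t : ℕ} (x : Fin (t + 1) → A) (i : Fin (t + 1)) : Fin (i.val + 1) → A :=
  fun j => x (Fin.castLE i.isLt j)

/-- The set `B_t` of the times up to `t` at which privacy was ON. -/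
def onTimes {t : ℕ} (f : Fin (t + 1) → Status) : Finset (Fin (t + 1)) :=
  Finset.univ.filter fun i => f i = ON

/-- The last time up to `t` at which privacy was ON, the maximum of `B_t`
(which is nonempty for all histories with `f 0 = ON`). -/
def lastOn {t : ℕ} (f : Fin (t + 1) → Status) : ℕ :=
  (onTimes f).sup fun i => i.val

/-- The status history `f = (f_0, …, f_t)` has positive probability under the law `ν` of the
status process. -/
def Possible (ν : Measure (ℕ → Status)) {t : ℕ} (f : Fin (t + 1) → Status) : Prop :=
  0 < ν {F | ∀ i : Fin (t + 1), F i = f i}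

/-- The conditional mutual information `I(U; V | Z)` for a variable `Z` with countably many values:
the average over `z` of the Kullback-Leibler divergence of the joint law of `(U, V)` given `Z = z`
from the product of the two laws given `Z = z`. -/
noncomputable def condMutualInfo {Ω A B C : Type*} [MeasurableSpace Ω] [MeasurableSpace A]
    [MeasurableSpace B] (μ : Measure Ω) (U : Ω → A) (V : Ω → B) (Z : Ω → C) : ℝ≥0∞ :=
  ∑' z : C, μ (Z ⁻¹' {z}) *
    InformationTheory.klDiv
      ((ProbabilityTheory.cond μ (Z ⁻¹' {z})).map fun ω => (U ω, V ω))
      (((ProbabilityTheory.cond μ (Z ⁻¹' {z})).map U).prod ((ProbabilityTheory.cond μ (Z ⁻¹' {z})).map V))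

/-- The probability that a Markov chain with initial distribution `π₀` and transition matrix `P`
starts with the path `x = (x_0, …, x_t)`. -/
noncomputable def pathProb {N : ℕ} (π₀ : Fin N → ℝ) (P : Matrix (Fin N) (Fin N) ℝ) {t : ℕ}
    (x : Fin (t + 1) → Fin N) : ℝ :=
  π₀ (x 0) * ∏ i : Fin t, P (x i.castSucc) (x i.succ)

/-- A causal ON-OFF privacy system with `N` sources and messages of `L` bits. -/
structure Code (N L : ℕ) where
  /-- the alphabet of the local randomness -/
  S : Type
  [measurableSpaceS : MeasurableSpace S]
  /-- the alphabet of the queries -/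
  Q : Type
  [measurableSpaceQ : MeasurableSpace Q]
  [discreteQ : DiscreteMeasurableSpace Q]
  [countableQ : Countable Q]
  /-- the law of `S_t` given `X_[t]`, `F_[t]` and `S_[t-1]` -/
  rand : (t : ℕ) → (Fin (t + 1) → Fin N) → (Fin (t + 1) → Status) → Kernel (Fin t → S) S
  [markov_rand : ∀ t x f, IsMarkovKernel (rand t x f)]
  /-- the query encoding function, `Q_t = query t X_[t] F_[t] S_[t]` -/
  query : (t : ℕ) → (Fin (t + 1) → Fin N) → (Fin (t + 1) → Status) → (Fin (t + 1) → S) → Q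
  measurable_query : ∀ t x f, Measurable (query t x f)
  /-- the length of the answer, in bits -/
  len : Q → ℕ
  len_le : ∀ q, len q ≤ N * L
  /-- the answer to a query, computed from the current messages of the `N` sources -/
  answer : ℕ → (q : Q) → (Fin N → Fin L → Bool) → Fin (len q) → Bool
  /-- the decoder at time `t`, which sees the answer, `X_t` and `S_t` -/
  decode : ℕ → (n : ℕ) → (Fin n → Bool) → Fin N → S → Fin L → Bool

attribute [instance] Code.measurableSpaceS Code.measurableSpaceQ Code.discreteQ Code.countableQ
  Code.markov_rand

namespace Code

variable {N L : ℕ}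

/-- The law of the local randomness `S_0, …, S_{t-1}` given the requests `x` and the privacy
statuses `f` at the times `0, …, t-1`. -/
noncomputable def randLaw (c : Code N L) :
    (t : ℕ) → (Fin t → Fin N) → (Fin t → Status) → Measure (Fin t → c.S)
  | 0, _, _ => Measure.dirac Fin.elim0
  | t + 1, x, f =>
    (c.randLaw t (Fin.init x) (Fin.init f) ⊗ₘ c.rand t x f).map
      fun p => Fin.snoc (α := fun _ => c.S) p.1 p.2

/-- The law of `(X_[t], S_[t])` given `F_[t] = f`. The requests are independent of the privacy
statuses, so they still form the given Markov chain. -/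
noncomputable def law (c : Code N L) (π₀ : Fin N → ℝ) (P : Matrix (Fin N) (Fin N) ℝ) {t : ℕ}
    (f : Fin (t + 1) → Status) : Measure ((Fin (t + 1) → Fin N) × (Fin (t + 1) → c.S)) :=
  ∑ x : Fin (t + 1) → Fin N,
    ENNReal.ofReal (pathProb π₀ P x) • (Measure.dirac x).prod (c.randLaw (t + 1) x f)

/-- The query `Q_i`, for a time `i ≤ t`, as a function of the requests and the local randomness. -/
def queryAt (c : Code N L) {t : ℕ} (f : Fin (t + 1) → Status) (i : Fin (t + 1))
    (z : (Fin (t + 1) → Fin N) × (Fin (t + 1) → c.S)) : c.Q :=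
  c.query i.val (upTo z.1 i) (upTo f i) (upTo z.2 i)

/-- The previous queries `Q_[t-1] = (Q_0, …, Q_{t-1})`. -/
def pastQueries (c : Code N L) {t : ℕ} (f : Fin (t + 1) → Status)
    (z : (Fin (t + 1) → Fin N) × (Fin (t + 1) → c.S)) : Fin t → c.Q :=
  fun i => c.queryAt f i.castSucc z

/-- The requests `X_{B_t}` made at the times when privacy was ON. -/
def privateRequests (c : Code N L) {t : ℕ} (f : Fin (t + 1) → Status)
    (z : (Fin (t + 1) → Fin N) × (Fin (t + 1) → c.S)) : onTimes f → Fin N :=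
  fun i => z.1 i.val

/-- Zero-error decodability at time `t`, given `F_[t] = f`: the current messages are uniform and
independent of the requests and of the local randomness, and the decoded message is almost surely
the requested one. -/
def Decodable (c : Code N L) (π₀ : Fin N → ℝ) (P : Matrix (Fin N) (Fin N) ℝ) {t : ℕ}
    (f : Fin (t + 1) → Status) : Prop :=
  ∀ᵐ zw ∂((c.law π₀ P f).prod (PMF.uniformOfFintype (Fin N → Fin L → Bool)).toMeasure),
    c.decode t (c.len (c.queryAt f (Fin.last t) zw.1))
      (c.answer t (c.queryAt f (Fin.last t) zw.1) zw.2)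
      (zw.1.1 (Fin.last t)) (zw.1.2 (Fin.last t)) = zw.2 (zw.1.1 (Fin.last t))

/-- Privacy at time `t`, given `F_[t] = f`: `I(X_{B_t}; Q_t | Q_[t-1]) = 0`. -/
def Private (c : Code N L) (π₀ : Fin N → ℝ) (P : Matrix (Fin N) (Fin N) ℝ) {t : ℕ}
    (f : Fin (t + 1) → Status) : Prop :=
  condMutualInfo (c.law π₀ P f) (c.privateRequests f) (c.queryAt f (Fin.last t))
    (c.pastQueries f) = 0

/-- The average length of the answer at time `t`, given `F_[t] = f`. -/
noncomputable def avgLen (c : Code N L) (π₀ : Fin N → ℝ) (P : Matrix (Fin N) (Fin N) ℝ) {t : ℕ}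
    (f : Fin (t + 1) → Status) : ℝ :=
  ∫ z, (c.len (c.queryAt f (Fin.last t) z) : ℝ) ∂(c.law π₀ P f)

end Code

/-- The rate tuple `R` is achievable, for requests that form a Markov chain with initial
distribution `π₀` and transition matrix `P`, and privacy statuses with law `ν`. The rate at time `t`
may depend on the privacy statuses up to time `t`, which the user and the server know; a single
code, which is causal in the statuses, has to serve all of the status histories that can occur. -/
def Achievable {N : ℕ} (π₀ : Fin N → ℝ) (P : Matrix (Fin N) (Fin N) ℝ)
    (ν : Measure (ℕ → Status)) (R : (t : ℕ) → (Fin (t + 1) → Status) → ℝ) : Prop :=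
  ∃ (L : ℕ) (_ : 0 < L) (c : Code N L),
    ∀ (t : ℕ) (f : Fin (t + 1) → Status), Possible ν f →
      c.Decodable π₀ P f ∧ c.Private π₀ P f ∧ R t f ≤ (L : ℝ) / c.avgLen π₀ P f

end OnOffPrivacy

/-!
Write `λ = 1 - α - β` for the second eigenvalue of the transition matrix `P`, and `τ` for the last
time when privacy was ON.

*Achievability.* Each row of `P` is the sum of the common part `y ↦ min_x P x y`, of mass `1 - |λ|`,
and a remainder of mass `|λ|`. The user keeps a flag, raised whenever privacy is ON; when it is OFF,
the flag stays up only if the last transition is attributed to the remainder (`stayProb`). Both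
messages are downloaded while the flag is up, and only the requested one afterwards. When the flag
drops, the request has the law of the common part, whatever the past was. So, while privacy is OFF,
the next query depends on all past requests and randomness only through the previous query
(`couplingCode.lintegral_law_succ_of_off`), which gives privacy; and the flag is still up at time `t`
with probability `|λ| ^ (t - τ)` (`couplingCode.law_queryAt_eq_none`).

*Converse.* If a query occurs together with both values of the current request, its answer determines
both messages, so it has at least `2 * L` bits (`Code.exists_decoder`); any other query reveals the
request `X_t`. Suppose that, given the queries before `τ`, both values of `X_τ` remain possible
(`Code.FullSupport`). Conditioning `X_τ` to be `x`, separately for each value of those queries, does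
not change the law of the queries up to time `t`, by privacy, but makes the law of `X_t` the row `x`
of `P ^ (t - τ)` (`Code.HasTilts`). Hence the queries that reveal `X_t = y` have probability at most
`min_x (P ^ (t - τ)) x y` (`Code.law_revealing_le`), and those that reveal nothing have probability at
least the distance `|λ| ^ (t - τ)` of the two rows.

Full support holds if all entries of `P` are positive (`Code.fullSupport_succ_of_pos`). If `P` is a
permutation matrix, `X_τ` is a function of `X_0`, which is private forever
(`Code.fullSupportAfter_of_deterministic`). If privacy never switches from OFF to ON, then all
requests up to `τ` are private, and each value of `X_τ` can be reached as no column of `P` vanishes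
(`Code.fullSupport_of_no_switch`).
-/

namespace OnOffPrivacy

/-! ### One step of the law, and privacy as conditional independence -/

lemma measurable_snoc {S : Type*} [MeasurableSpace S] (t : ℕ) :
    Measurable fun p : (Fin t → S) × S => Fin.snoc (α := fun _ => S) p.1 p.2 := by
  refine measurable_pi_iff.2 fun i => ?_
  induction i using Fin.lastCases with
  | last => simpa using measurable_snd
  | cast i =>
    simp only [Fin.snoc_castSucc]
    exact (measurable_pi_apply i).comp measurable_fst

lemma measurable_init {S : Type*} [MeasurableSpace S] (t : ℕ) :
    Measurable fun s : Fin (t + 1) → S => Fin.init (α := fun _ => S) s :=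
  measurable_pi_iff.2 fun i => measurable_pi_apply i.castSucc

/-- Forgetting the last time step of a finite trajectory of requests and local randomness. -/
def forgetLast {A S : Type*} {t : ℕ} (z : (Fin (t + 1) → A) × (Fin (t + 1) → S)) :
    (Fin t → A) × (Fin t → S) :=
  (Fin.init z.1, Fin.init z.2)

/-- For a conditioning variable with countably many values, vanishing conditional mutual
information means that the variables are conditionally independent; for discrete variables this is
an identity between probabilities of elementary events. -/
lemma condMutualInfo_eq_zero_iff {Ω A B C : Type*} [MeasurableSpace Ω] [MeasurableSpace A]
    [MeasurableSpace B] [Countable A] [Countable B] [MeasurableSingletonClass A]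
    [MeasurableSingletonClass B] (μ : Measure Ω) [IsFiniteMeasure μ] {U : Ω → A} {V : Ω → B}
    {Z : Ω → C} (hU : Measurable U) (hV : Measurable V) (hZ : ∀ z, MeasurableSet (Z ⁻¹' {z})) :
    condMutualInfo μ U V Z = 0 ↔ ∀ z u v,
      μ (Z ⁻¹' {z}) * μ (Z ⁻¹' {z} ∩ (U ⁻¹' {u} ∩ V ⁻¹' {v})) =
        μ (Z ⁻¹' {z} ∩ U ⁻¹' {u}) * μ (Z ⁻¹' {z} ∩ V ⁻¹' {v}) := by
  rw [condMutualInfo, ENNReal.tsum_eq_zero]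
  refine forall_congr' fun z => ?_
  rw [mul_eq_zero]
  by_cases h0 : μ (Z ⁻¹' {z}) = 0
  · simp [h0, measure_mono_null Set.inter_subset_left h0]
  have : IsProbabilityMeasure (cond μ (Z ⁻¹' {z})) := cond_isProbabilityMeasure h0
  have := Measure.isProbabilityMeasure_map (μ := cond μ (Z ⁻¹' {z})) hU.aemeasurable
  have := Measure.isProbabilityMeasure_map (μ := cond μ (Z ⁻¹' {z})) hV.aemeasurable
  have := Measure.isProbabilityMeasure_map (μ := cond μ (Z ⁻¹' {z})) (hU.prodMk hV).aemeasurable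
  rw [InformationTheory.klDiv_eq_zero_iff, Measure.ext_iff_singleton, Prod.forall]
  simp only [h0, false_or]
  refine forall_congr' fun u => forall_congr' fun v => ?_
  have hfin : μ (Z ⁻¹' {z}) ≠ ∞ := measure_ne_top _ _
  rw [← Set.singleton_prod_singleton, Measure.prod_prod,
    Measure.map_apply (hU.prodMk hV) ((measurableSet_singleton u).prod (measurableSet_singleton v)),
    Measure.map_apply hU (measurableSet_singleton u),
    Measure.map_apply hV (measurableSet_singleton v), cond_apply (hZ z), cond_apply (hZ z),
    cond_apply (hZ z), Set.mk_preimage_prod]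
  generalize μ (Z ⁻¹' {z}) = m at *
  generalize μ (Z ⁻¹' {z} ∩ (U ⁻¹' {u} ∩ V ⁻¹' {v})) = a
  generalize μ (Z ⁻¹' {z} ∩ U ⁻¹' {u}) = b
  generalize μ (Z ⁻¹' {z} ∩ V ⁻¹' {v}) = c
  have hm : m * m⁻¹ = 1 := ENNReal.mul_inv_cancel h0 hfin
  constructor
  · intro h
    calc m * a = m * m * (m⁻¹ * a) := by rw [mul_assoc m m, ← mul_assoc m m⁻¹, hm, one_mul]
      _ = (m * m⁻¹) * b * ((m * m⁻¹) * c) := by rw [h]; ring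
      _ = b * c := by rw [hm]; ring
  · intro h
    calc m⁻¹ * a = m⁻¹ * m⁻¹ * (m * a) := by
          rw [mul_assoc, ← mul_assoc m⁻¹ m, mul_comm m⁻¹ m, hm, one_mul]
      _ = m⁻¹ * b * (m⁻¹ * c) := by rw [h]; ring

/-- Almost surely, a variable with countably many values takes a value of positive probability. -/
lemma ae_measure_fiber_ne_zero {Ω A : Type*} [MeasurableSpace Ω] [Countable A] (μ : Measure Ω)
    (V : Ω → A) : ∀ᵐ ω ∂μ, μ (V ⁻¹' {V ω}) ≠ 0 := by
  have : {ω | ¬ μ (V ⁻¹' {V ω}) ≠ 0} ⊆ ⋃ a : {a // μ (V ⁻¹' {a}) = 0}, V ⁻¹' {a.1} := by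
    intro ω hω
    exact Set.mem_iUnion.2 ⟨⟨V ω, not_not.1 hω⟩, rfl⟩
  exact measure_mono_null this (measure_iUnion_null fun a => a.2)

namespace Code

variable {N L : ℕ} (c : Code N L)

instance isProbabilityMeasure_randLaw : ∀ (t : ℕ) (x : Fin t → Fin N) (f : Fin t → Status),
    IsProbabilityMeasure (c.randLaw t x f)
  | 0, _, _ => by rw [randLaw]; infer_instance
  | t + 1, x, f => by
    have := isProbabilityMeasure_randLaw t (Fin.init x) (Fin.init f)
    rw [randLaw]
    exact Measure.isProbabilityMeasure_map (measurable_snoc t).aemeasurable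

lemma lintegral_randLaw_succ (t : ℕ) (x : Fin (t + 1) → Fin N) (f : Fin (t + 1) → Status)
    {h : (Fin (t + 1) → c.S) → ℝ≥0∞} (hh : Measurable h) :
    ∫⁻ s, h s ∂(c.randLaw (t + 1) x f) =
      ∫⁻ s, ∫⁻ r, h (Fin.snoc (α := fun _ => c.S) s r) ∂(c.rand t x f s)
        ∂(c.randLaw t (Fin.init x) (Fin.init f)) := by
  rw [randLaw, lintegral_map hh (measurable_snoc t),
    Measure.lintegral_compProd (f := fun p => h (Fin.snoc (α := fun _ => c.S) p.1 p.2))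
      (hh.comp (measurable_snoc t))]

lemma measurable_queryAt {t : ℕ} (f : Fin (t + 1) → Status) (i : Fin (t + 1)) :
    Measurable (c.queryAt f i) := by
  refine measurable_from_prod_countable_right fun x => ?_
  have hs : Measurable fun s : Fin (t + 1) → c.S => upTo s i :=
    measurable_pi_iff.2 fun j => measurable_pi_apply _
  exact (c.measurable_query i.val (upTo x i) (upTo f i)).comp hs

/-- The queries `Q_[t] = (Q_0, …, Q_t)`, the current one included. -/
def queries {t : ℕ} (f : Fin (t + 1) → Status)
    (z : (Fin (t + 1) → Fin N) × (Fin (t + 1) → c.S)) : Fin (t + 1) → c.Q :=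
  fun i => c.queryAt f i z

lemma measurable_queries {t : ℕ} (f : Fin (t + 1) → Status) : Measurable (c.queries f) :=
  measurable_pi_iff.2 fun i => c.measurable_queryAt f i

lemma measurable_pastQueries {t : ℕ} (f : Fin (t + 1) → Status) : Measurable (c.pastQueries f) :=
  measurable_pi_iff.2 fun i => c.measurable_queryAt f i.castSucc

lemma measurable_privateRequests {t : ℕ} (f : Fin (t + 1) → Status) :
    Measurable (c.privateRequests f) :=
  measurable_pi_iff.2 fun i => (measurable_pi_apply i.1).comp measurable_fst

lemma measurable_request {t : ℕ} (i : Fin (t + 1)) :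
    Measurable fun z : (Fin (t + 1) → Fin N) × (Fin (t + 1) → c.S) => z.1 i :=
  (measurable_pi_apply i).comp measurable_fst

lemma measurable_forgetLast {t : ℕ} :
    Measurable (forgetLast : (Fin (t + 1) → Fin N) × (Fin (t + 1) → c.S) → _) :=
  ((measurable_init t).comp measurable_fst).prodMk ((measurable_init t).comp measurable_snd)

lemma pastQueries_eq_queries_init {t : ℕ} (f : Fin (t + 2) → Status)
    (z : (Fin (t + 2) → Fin N) × (Fin (t + 2) → c.S)) :
    c.pastQueries f z = c.queries (Fin.init f) (forgetLast z) := rfl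

variable (π₀ : Fin N → ℝ) (P : Matrix (Fin N) (Fin N) ℝ)

lemma lintegral_law {t : ℕ} (f : Fin (t + 1) → Status)
    {h : (Fin (t + 1) → Fin N) × (Fin (t + 1) → c.S) → ℝ≥0∞} (hh : Measurable h) :
    ∫⁻ z, h z ∂(c.law π₀ P f) = ∑ x : Fin (t + 1) → Fin N,
      ENNReal.ofReal (pathProb π₀ P x) * ∫⁻ s, h (x, s) ∂(c.randLaw (t + 1) x f) := by
  simp only [law, lintegral_finsetSum_measure, lintegral_smul_measure, smul_eq_mul]
  refine Finset.sum_congr rfl fun x _ => ?_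
  rw [Measure.dirac_prod, lintegral_map hh (by fun_prop)]

variable {π₀ P}

lemma pathProb_snoc {t : ℕ} (x : Fin (t + 1) → Fin N) (y : Fin N) :
    pathProb π₀ P (Fin.snoc (α := fun _ => Fin N) x y : Fin (t + 2) → Fin N) =
      pathProb π₀ P x * P (x (Fin.last t)) y := by
  have h0 : (Fin.snoc (α := fun _ => Fin N) x y : Fin (t + 2) → Fin N) 0 = x 0 :=
    Fin.snoc_castSucc (α := fun _ => Fin N) (i := (0 : Fin (t + 1))) ..
  rw [pathProb, pathProb, h0, Fin.prod_univ_castSucc, mul_assoc]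
  congr 2
  · refine Finset.prod_congr rfl fun i _ => ?_
    rw [Fin.snoc_castSucc, Fin.succ_castSucc, Fin.snoc_castSucc]
  · rw [Fin.snoc_castSucc, Fin.succ_last, Fin.snoc_last]

lemma pathProb_nonneg (hπ : ∀ x, 0 ≤ π₀ x) (hP : ∀ x y, 0 ≤ P x y) {t : ℕ}
    (x : Fin (t + 1) → Fin N) : 0 ≤ pathProb π₀ P x :=
  mul_nonneg (hπ _) (Finset.prod_nonneg fun _ _ => hP _ _)

/-- The law at time `t + 1` is obtained from the law at time `t` by a step of the Markov chain
followed by a draw of the new local randomness. -/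
lemma lintegral_law_succ (hπ : ∀ x, 0 ≤ π₀ x) (hP : ∀ x y, 0 ≤ P x y)
    {t : ℕ} (f : Fin (t + 2) → Status)
    {h : (Fin (t + 2) → Fin N) × (Fin (t + 2) → c.S) → ℝ≥0∞} (hh : Measurable h) :
    ∫⁻ z, h z ∂(c.law π₀ P f) = ∫⁻ z, ∑ y, ENNReal.ofReal (P (z.1 (Fin.last t)) y) *
      ∫⁻ r, h (Fin.snoc (α := fun _ => Fin N) z.1 y, Fin.snoc (α := fun _ => c.S) z.2 r)
        ∂(c.rand (t + 1) (Fin.snoc (α := fun _ => Fin N) z.1 y) f z.2)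
      ∂(c.law π₀ P (Fin.init f)) := by
  have hin : ∀ (x : Fin (t + 2) → Fin N), Measurable fun s : Fin (t + 1) → c.S =>
      ∫⁻ r, h (x, Fin.snoc (α := fun _ => c.S) s r) ∂(c.rand (t + 1) x f s) := fun x =>
    Measurable.lintegral_kernel_prod_right
      ((hh.comp (measurable_prodMk_left (x := x))).comp (measurable_snoc (t + 1)))
  rw [lintegral_law _ _ _ _ hh, lintegral_law]
  · rw [← (Fin.snocEquiv fun _ => Fin N).sum_comp, Fintype.sum_prod_type_right]
    refine Finset.sum_congr rfl fun x _ => ?_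
    have hsum := lintegral_finsetSum (μ := c.randLaw (t + 1) x (Fin.init f)) Finset.univ
      fun y _ => (hin (Fin.snoc (α := fun _ => Fin N) x y)).const_mul
        (ENNReal.ofReal (P (x (Fin.last t)) y))
    refine Eq.trans ?_ (congrArg (_ * ·) hsum).symm
    simp only [Finset.mul_sum]
    refine Finset.sum_congr rfl fun y _ => ?_
    have hx : Fin.snocEquiv (fun _ => Fin N) (y, x) = Fin.snoc (α := fun _ => Fin N) x y := rfl
    have hrand := c.lintegral_randLaw_succ (t + 1) (Fin.snoc (α := fun _ => Fin N) x y) f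
      (h := fun s => h (Fin.snoc (α := fun _ => Fin N) x y, s)) (hh.comp measurable_prodMk_left)
    rw [hx, pathProb_snoc, ENNReal.ofReal_mul (pathProb_nonneg hπ hP x), hrand,
      lintegral_const_mul _ (hin _), mul_assoc, Fin.init_snoc]
  · refine measurable_from_prod_countable_right fun x => ?_
    exact Finset.measurable_fun_sum _ fun y _ =>
      (hin (Fin.snoc (α := fun _ => Fin N) x y)).const_mul (ENNReal.ofReal (P (x (Fin.last t)) y))

/-- The Markov property: the next request depends on the past only through the current one. -/
lemma lintegral_law_succ_request (hπ : ∀ x, 0 ≤ π₀ x) (hP : ∀ x y, 0 ≤ P x y)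
    {t : ℕ} (f : Fin (t + 2) → Status)
    {g : (Fin (t + 1) → Fin N) × (Fin (t + 1) → c.S) → ℝ≥0∞} (hg : Measurable g)
    (k : Fin N → ℝ≥0∞) :
    ∫⁻ z, g (forgetLast z) * k (z.1 (Fin.last (t + 1))) ∂(c.law π₀ P f) =
      ∫⁻ z, g z * ∑ y, ENNReal.ofReal (P (z.1 (Fin.last t)) y) * k y
        ∂(c.law π₀ P (Fin.init f)) := by
  refine (lintegral_law_succ c hπ hP f
    ((hg.comp c.measurable_forgetLast).mul ((Measurable.of_discrete (f := k)).comp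
      (c.measurable_request (Fin.last (t + 1)))))).trans (lintegral_congr fun z => ?_)
  simp only [Pi.mul_apply, Function.comp_apply, forgetLast, Fin.init_snoc, Fin.snoc_last,
    lintegral_const, measure_univ, mul_one,
    Finset.mul_sum]
  exact Finset.sum_congr rfl fun y _ => by ring

lemma sum_ofReal_eq_one {p : Fin N → ℝ} (hp : ∀ x, 0 ≤ p x) (hp1 : ∑ x, p x = 1) :
    ∑ x, ENNReal.ofReal (p x) = 1 := by
  rw [← ENNReal.ofReal_sum_of_nonneg fun x _ => hp x, hp1, ENNReal.ofReal_one]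

lemma lintegral_law_forgetLast (hπ : ∀ x, 0 ≤ π₀ x) (hP : ∀ x y, 0 ≤ P x y)
    (hP1 : ∀ x, ∑ y, P x y = 1) {t : ℕ} (f : Fin (t + 2) → Status)
    {g : (Fin (t + 1) → Fin N) × (Fin (t + 1) → c.S) → ℝ≥0∞} (hg : Measurable g) :
    ∫⁻ z, g (forgetLast z) ∂(c.law π₀ P f) = ∫⁻ z, g z ∂(c.law π₀ P (Fin.init f)) := by
  simpa [sum_ofReal_eq_one (hP _) (hP1 _)] using
    c.lintegral_law_succ_request hπ hP f hg (fun _ => 1)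

lemma law_preimage_forgetLast (hπ : ∀ x, 0 ≤ π₀ x) (hP : ∀ x y, 0 ≤ P x y)
    (hP1 : ∀ x, ∑ y, P x y = 1) {t : ℕ} (f : Fin (t + 2) → Status)
    {E : Set ((Fin (t + 1) → Fin N) × (Fin (t + 1) → c.S))} (hE : MeasurableSet E) :
    c.law π₀ P f (forgetLast ⁻¹' E) = c.law π₀ P (Fin.init f) E := by
  rw [← lintegral_indicator_one hE, ← c.lintegral_law_forgetLast hπ hP hP1 f
    (measurable_one.indicator hE), ← lintegral_indicator_one (c.measurable_forgetLast hE)]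
  rfl

lemma isProbabilityMeasure_law (hπ : ∀ x, 0 ≤ π₀ x) (hπ1 : ∑ x, π₀ x = 1)
    (hP : ∀ x y, 0 ≤ P x y) (hP1 : ∀ x, ∑ y, P x y = 1) :
    ∀ {t : ℕ} (f : Fin (t + 1) → Status), IsProbabilityMeasure (c.law π₀ P f)
  | 0, f => by
    refine ⟨?_⟩
    rw [← lintegral_one, lintegral_law _ _ _ _ measurable_const,
      ← (Equiv.funUnique (Fin 1) (Fin N)).symm.sum_comp]
    simpa [pathProb] using sum_ofReal_eq_one hπ hπ1
  | t + 1, f => by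
    have := isProbabilityMeasure_law hπ hπ1 hP hP1 (Fin.init f)
    refine ⟨?_⟩
    rw [← Set.preimage_univ (f := forgetLast),
      c.law_preimage_forgetLast hπ hP hP1 f MeasurableSet.univ, measure_univ]

/-- Privacy in terms of probabilities of events: `X_B` and `Q_t` are conditionally independent given
the past queries. -/
lemma private_iff {t : ℕ} (f : Fin (t + 1) → Status) [IsFiniteMeasure (c.law π₀ P f)] :
    c.Private π₀ P f ↔ ∀ z u q,
      c.law π₀ P f (c.pastQueries f ⁻¹' {z}) *
          c.law π₀ P f (c.pastQueries f ⁻¹' {z} ∩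
            (c.privateRequests f ⁻¹' {u} ∩ c.queryAt f (Fin.last t) ⁻¹' {q})) =
        c.law π₀ P f (c.pastQueries f ⁻¹' {z} ∩ c.privateRequests f ⁻¹' {u}) *
          c.law π₀ P f (c.pastQueries f ⁻¹' {z} ∩ c.queryAt f (Fin.last t) ⁻¹' {q}) :=
  condMutualInfo_eq_zero_iff _ (c.measurable_privateRequests f) (c.measurable_queryAt f _)
    fun z => c.measurable_pastQueries f (measurableSet_singleton z)

end Code

lemma mem_onTimes {t : ℕ} {f : Fin (t + 1) → Status} {i : Fin (t + 1)} :
    i ∈ onTimes f ↔ f i = ON := by simp [onTimes]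

lemma lastOn_of_last_on {t : ℕ} {f : Fin (t + 1) → Status} (h : f (Fin.last t) = ON) :
    lastOn f = t :=
  le_antisymm (Finset.sup_le fun i _ => Nat.lt_succ_iff.1 i.2)
    (Finset.le_sup (f := fun i : Fin (t + 1) => i.val) (mem_onTimes.2 h))

lemma lastOn_of_last_off {t : ℕ} {f : Fin (t + 2) → Status} (h : f (Fin.last (t + 1)) = OFF) :
    lastOn f = lastOn (Fin.init f : Fin (t + 1) → Status) := by
  apply le_antisymm
  · refine Finset.sup_le fun i hi => ?_
    rw [mem_onTimes] at hi
    induction i using Fin.lastCases with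
    | last => simp [h] at hi
    | cast i =>
      exact Finset.le_sup (f := fun i : Fin (t + 1) => i.val) (mem_onTimes.2 hi)
  · refine Finset.sup_le fun i hi => ?_
    rw [mem_onTimes] at hi
    exact Finset.le_sup (f := fun i : Fin (t + 2) => i.val) (b := i.castSucc) (mem_onTimes.2 hi)

lemma lastOn_le {t : ℕ} (f : Fin (t + 1) → Status) : lastOn f ≤ t :=
  Finset.sup_le fun i _ => Nat.lt_succ_iff.1 i.2

lemma Possible.init {ν : Measure (ℕ → Status)} {t : ℕ} {f : Fin (t + 2) → Status}
    (h : Possible ν f) : Possible ν (Fin.init f : Fin (t + 1) → Status) :=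
  h.trans_le <| measure_mono fun _ hF i => hF i.castSucc

lemma Possible.zero_on {ν : Measure (ℕ → Status)} (hν : ∀ᵐ F ∂ν, F 0 = ON) {t : ℕ}
    {f : Fin (t + 1) → Status} (h : Possible ν f) : f 0 = ON := by
  by_contra hf
  refine h.ne' (measure_mono_null (fun F hF => ?_) hν)
  have := hF 0
  simp_all

/-! ### The coupling scheme -/

/-- The common part `y ↦ min_x P x y` of the two rows of a transition matrix. -/
noncomputable def commonPart (P : Matrix (Fin 2) (Fin 2) ℝ) (y : Fin 2) : ℝ :=
  min (P 0 y) (P 1 y)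

/-- The probability, given a transition from `x` to `y`, that it was not drawn from the common part
of the rows, when each row is written as the common part plus a remainder. -/
noncomputable def stayProb (P : Matrix (Fin 2) (Fin 2) ℝ) (x y : Fin 2) : ℝ :=
  (P x y - commonPart P y) / P x y

lemma commonPart_le (P : Matrix (Fin 2) (Fin 2) ℝ) (x y : Fin 2) : commonPart P y ≤ P x y := by
  fin_cases x
  · exact min_le_left _ _
  · exact min_le_right _ _

section Coupling

variable {P : Matrix (Fin 2) (Fin 2) ℝ}

lemma commonPart_nonneg (hP : ∀ x y, 0 ≤ P x y) (y : Fin 2) : 0 ≤ commonPart P y :=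
  le_min (hP _ _) (hP _ _)

lemma stayProb_nonneg (hP : ∀ x y, 0 ≤ P x y) (x y : Fin 2) : 0 ≤ stayProb P x y :=
  div_nonneg (sub_nonneg.2 (commonPart_le P x y)) (hP x y)

lemma stayProb_le_one (hP : ∀ x y, 0 ≤ P x y) (x y : Fin 2) : stayProb P x y ≤ 1 :=
  div_le_one_of_le₀ (by linarith [commonPart_nonneg hP y]) (hP x y)

lemma mul_stayProb (hP : ∀ x y, 0 ≤ P x y) (x y : Fin 2) :
    P x y * stayProb P x y = P x y - commonPart P y := by
  rcases (hP x y).eq_or_lt' with h | h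
  · -- division by zero: the common part vanishes too
    have h1 := commonPart_le P x y
    have h2 := commonPart_nonneg hP y
    rw [h] at h1 ⊢
    linarith
  · rw [stayProb, mul_div_cancel₀ _ h.ne']

lemma abs_eq_one_sub_commonPart (hP1 : ∀ x, ∑ y, P x y = 1) :
    |P 0 0 - P 1 0| = 1 - (commonPart P 0 + commonPart P 1) := by
  have h0 := hP1 0
  have h1 := hP1 1
  rw [Fin.sum_univ_two] at h0 h1
  rw [commonPart, commonPart]
  rcases le_total (P 0 0) (P 1 0) with h | h
  · rw [abs_of_nonpos (by linarith), min_eq_left h, min_eq_right (by linarith)]; linarith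
  · rw [abs_of_nonneg (by linarith), min_eq_right h, min_eq_left (by linarith)]; linarith

/-- The law of a Boolean that is true with probability `p`. -/
noncomputable def coin (p : ℝ) : Measure Bool :=
  ENNReal.ofReal p • Measure.dirac true + ENNReal.ofReal (1 - p) • Measure.dirac false

lemma isProbabilityMeasure_coin {p : ℝ} (h0 : 0 ≤ p) (h1 : p ≤ 1) :
    IsProbabilityMeasure (coin p) := by
  refine ⟨?_⟩
  simp [coin, ← ENNReal.ofReal_add h0 (sub_nonneg.2 h1)]

lemma lintegral_coin (p : ℝ) (h : Bool → ℝ≥0∞) :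
    ∫⁻ r, h r ∂(coin p) = ENNReal.ofReal p * h true + ENNReal.ofReal (1 - p) * h false := by
  simp [coin]

/-- The probability that the flag of the coupling scheme is raised: always when privacy is ON; when
it is OFF, only if the flag was up before and the last transition was not drawn from the common
part of the rows. -/
noncomputable def flagProb (P : Matrix (Fin 2) (Fin 2) ℝ) :
    (t : ℕ) → (Fin (t + 1) → Fin 2) → (Fin (t + 1) → Status) → (Fin t → Bool) → ℝ
  | 0, _, _, _ => 1
  | t + 1, x, f, s =>
    if f (Fin.last (t + 1)) = ON then 1
    else if s (Fin.last t) then stayProb P (x (Fin.last t).castSucc) (x (Fin.last (t + 1)))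
    else 0

lemma flagProb_mem (hP : ∀ x y, 0 ≤ P x y) : ∀ (t : ℕ) (x : Fin (t + 1) → Fin 2)
    (f : Fin (t + 1) → Status) (s : Fin t → Bool), 0 ≤ flagProb P t x f s ∧ flagProb P t x f s ≤ 1
  | 0, _, _, _ => ⟨zero_le_one, le_rfl⟩
  | t + 1, x, f, s => by
    rw [flagProb]
    split_ifs
    · exact ⟨zero_le_one, le_rfl⟩
    · exact ⟨stayProb_nonneg hP _ _, stayProb_le_one hP _ _⟩
    · exact ⟨le_rfl, zero_le_one⟩

lemma flagProb_of_last_on {t : ℕ} (x : Fin (t + 1) → Fin 2) {f : Fin (t + 1) → Status}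
    (hf : f (Fin.last t) = ON) (s : Fin t → Bool) : flagProb P t x f s = 1 := by
  cases t with
  | zero => rfl
  | succ t => rw [flagProb, if_pos hf]

/-- The queries of the coupling scheme carry the discrete measurable structure. -/
instance measurableSpaceOptionFin : MeasurableSpace (Option (Fin 2)) := ⊤

instance discreteMeasurableSpaceOptionFin : DiscreteMeasurableSpace (Option (Fin 2)) :=
  ⟨fun _ => trivial⟩

/-- The coupling scheme, with messages of one bit. The local randomness is a flag, raised with
probability `flagProb`. While it is up, the user downloads both messages (query `none`); once it is
down, only the requested message `x` (query `some x`). -/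
noncomputable abbrev couplingCode (hP : ∀ x y, 0 ≤ P x y) : Code 2 1 where
  S := Bool
  Q := Option (Fin 2)
  rand := fun t x f => ⟨fun s => coin (flagProb P t x f s), Measurable.of_discrete⟩
  markov_rand := fun t x f => ⟨fun s =>
    isProbabilityMeasure_coin (flagProb_mem hP t x f s).1 (flagProb_mem hP t x f s).2⟩
  query := fun t x _ s => if s (Fin.last t) then none else some (x (Fin.last t))
  measurable_query := fun _ _ _ => Measurable.of_discrete
  len := fun q => q.elim 2 fun _ => 1
  len_le := fun q => by cases q <;> simp
  answer := fun _ q w => match q with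
    | none => fun i => w i 0
    | some x => fun _ => w x 0
  decode := fun _ n a x _ _ =>
    if h : x.val < n then a ⟨x, h⟩ else if h : 0 < n then a ⟨0, h⟩ else false

/-- The transition probabilities of the queries of the coupling scheme while privacy is OFF. -/
noncomputable def queryStep (P : Matrix (Fin 2) (Fin 2) ℝ) :
    Option (Fin 2) → Option (Fin 2) → ℝ≥0∞
  | none, none => ENNReal.ofReal |P 0 0 - P 1 0|
  | none, some y => ENNReal.ofReal (commonPart P y)
  | some _, none => 0
  | some x, some y => ENNReal.ofReal (P x y)

namespace couplingCode

variable (hP : ∀ x y, 0 ≤ P x y) {π₀ : Fin 2 → ℝ}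

lemma queryAt_last {t : ℕ} (f : Fin (t + 1) → Status)
    (z : (Fin (t + 1) → Fin 2) × (Fin (t + 1) → Bool)) :
    (couplingCode hP).queryAt f (Fin.last t) z =
      if z.2 (Fin.last t) then none else some (z.1 (Fin.last t)) := rfl

lemma decodable (π₀ : Fin 2 → ℝ) {t : ℕ} (f : Fin (t + 1) → Status) :
    (couplingCode hP).Decodable π₀ P f := by
  have key : ∀ (q : Option (Fin 2)) (x : Fin 2) (s : Bool) (w : Fin 2 → Fin 1 → Bool),
      (q = none ∨ q = some x) →
      (couplingCode hP).decode t ((couplingCode hP).len q) ((couplingCode hP).answer t q w) x s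
        = w x := by
    rintro q x s w (rfl | rfl) <;> funext j <;> fin_cases x <;>
      simp [couplingCode, Subsingleton.elim j 0]
  refine Filter.Eventually.of_forall fun zw => key _ _ _ _ ?_
  rw [queryAt_last]
  split_ifs
  · exact Or.inl rfl
  · exact Or.inr rfl

/-- While privacy is OFF, the new query depends on the past requests and queries only through the
previous query. -/
lemma lintegral_law_succ_of_off (hπ : ∀ x, 0 ≤ π₀ x) (hP1 : ∀ x, ∑ y, P x y = 1) {t : ℕ}
    {f : Fin (t + 2) → Status} (hf : f (Fin.last (t + 1)) = OFF)
    {g : (Fin (t + 1) → Fin 2) × (Fin (t + 1) → Bool) → ℝ≥0∞} (hg : Measurable g)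
    (q : Option (Fin 2)) :
    ∫⁻ z, g (forgetLast z) * ({q} : Set (Option (Fin 2))).indicator 1
        ((couplingCode hP).queryAt f (Fin.last (t + 1)) z) ∂((couplingCode hP).law π₀ P f) =
      ∫⁻ z, g z * queryStep P ((couplingCode hP).queryAt (Fin.init f) (Fin.last t) z) q
        ∂((couplingCode hP).law π₀ P (Fin.init f)) := by
  refine ((couplingCode hP).lintegral_law_succ hπ hP f
    (h := fun z => g (forgetLast z) * ({q} : Set (Option (Fin 2))).indicator 1
        ((couplingCode hP).queryAt f (Fin.last (t + 1)) z))
    ((hg.comp (couplingCode hP).measurable_forgetLast).mul ((Measurable.of_discrete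
      (f := ({q} : Set (Option (Fin 2))).indicator 1)).comp
        ((couplingCode hP).measurable_queryAt f _)))).trans (lintegral_congr fun z => ?_)
  have hcoin : ∀ y, (couplingCode hP).rand (t + 1) (Fin.snoc (α := fun _ => Fin 2) z.1 y) f z.2 =
      coin (if z.2 (Fin.last t) then stayProb P (z.1 (Fin.last t)) y else 0) := by
    intro y
    change coin (flagProb P (t + 1) _ f z.2) = _
    rw [flagProb, hf, if_neg (by decide), Fin.snoc_castSucc, Fin.snoc_last]
  have hint : ∀ y (r : Bool), (couplingCode hP).queryAt f (Fin.last (t + 1))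
      (Fin.snoc (α := fun _ => Fin 2) z.1 y, Fin.snoc (α := fun _ => Bool) z.2 r) =
        if r then none else some y := by
    intro y r
    rw [queryAt_last]
    simp
  have hforget : ∀ y (r : Bool), forgetLast (Fin.snoc (α := fun _ => Fin 2) z.1 y,
      Fin.snoc (α := fun _ => Bool) z.2 r) = z := by
    intro y r
    simp [forgetLast]
  simp only [hcoin]
  have hl := fun y => lintegral_coin
    (if z.2 (Fin.last t) then stayProb P (z.1 (Fin.last t)) y else 0)
    (fun r => g z * ({q} : Set (Option (Fin 2))).indicator 1 (if r then none else some y))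
  have h2 : ∀ y, ∫⁻ r, g (forgetLast (Fin.snoc (α := fun _ => Fin 2) z.1 y,
        Fin.snoc (α := fun _ => Bool) z.2 r)) *
      ({q} : Set (Option (Fin 2))).indicator 1 ((couplingCode hP).queryAt f (Fin.last (t + 1))
        (Fin.snoc (α := fun _ => Fin 2) z.1 y, Fin.snoc (α := fun _ => Bool) z.2 r))
      ∂(coin (if z.2 (Fin.last t) then stayProb P (z.1 (Fin.last t)) y else 0)) = _ :=
    fun y => (lintegral_congr fun r => by rw [hint, hforget]).trans (hl y)
  refine (Finset.sum_congr rfl fun y _ => congrArg (_ * ·) (h2 y)).trans ?_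
  rw [queryAt_last]
  generalize z.1 (Fin.last t) = x
  have hstay : ∀ y, ENNReal.ofReal (P x y) * ENNReal.ofReal (stayProb P x y) =
      ENNReal.ofReal (P x y - commonPart P y) := fun y => by
    rw [← ENNReal.ofReal_mul (hP x y), mul_stayProb hP]
  have hleave : ∀ y, ENNReal.ofReal (P x y) * ENNReal.ofReal (1 - stayProb P x y) =
      ENNReal.ofReal (commonPart P y) := fun y => by
    rw [← ENNReal.ofReal_mul (hP x y), mul_sub, mul_stayProb hP]
    congr 1
    ring
  have hsum : ENNReal.ofReal (P x 0 - commonPart P 0) + ENNReal.ofReal (P x 1 - commonPart P 1) =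
      ENNReal.ofReal |P 0 0 - P 1 0| := by
    rw [← ENNReal.ofReal_add (sub_nonneg.2 (commonPart_le P x 0))
      (sub_nonneg.2 (commonPart_le P x 1)), abs_eq_one_sub_commonPart hP1]
    have := hP1 x
    rw [Fin.sum_univ_two] at this
    congr 1
    linarith
  have hc : ∀ a b d : ℝ≥0∞, a * (b * d) = d * (a * b) := fun a b d => by ring
  rw [Fin.sum_univ_two]
  rcases q with _ | q
  · by_cases hs : z.2 (Fin.last t) = true
    · simp [hs, queryStep, hc, hstay, ← mul_add, hsum]
    · simp [hs, queryStep]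
  · by_cases hs : z.2 (Fin.last t) = true
    · fin_cases q <;> simp [hs, queryStep, hc, hleave]
    · fin_cases q <;> simp [hs, queryStep, mul_comm]

/-- While privacy is ON, the user downloads both messages. -/
lemma ae_queryAt_eq_none_of_on (π₀ : Fin 2 → ℝ) {t : ℕ} {f : Fin (t + 1) → Status}
    (hf : f (Fin.last t) = ON) :
    ∀ᵐ z ∂((couplingCode hP).law π₀ P f), (couplingCode hP).queryAt f (Fin.last t) z = none := by
  have hm : Measurable fun z => ({none}ᶜ : Set (Option (Fin 2))).indicator (1 : Option (Fin 2) → ℝ≥0∞)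
      ((couplingCode hP).queryAt f (Fin.last t) z) :=
    (Measurable.of_discrete (f := ({none}ᶜ : Set (Option (Fin 2))).indicator 1)).comp
      ((couplingCode hP).measurable_queryAt f (Fin.last t))
  have h0 : ∫⁻ z, ({none}ᶜ : Set (Option (Fin 2))).indicator (1 : Option (Fin 2) → ℝ≥0∞)
      ((couplingCode hP).queryAt f (Fin.last t) z) ∂((couplingCode hP).law π₀ P f) = 0 := by
    rw [(couplingCode hP).lintegral_law π₀ P f hm]
    refine Finset.sum_eq_zero fun x _ => mul_eq_zero_of_right _ ?_
    refine ((couplingCode hP).lintegral_randLaw_succ t x f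
      (h := fun s => ({none}ᶜ : Set (Option (Fin 2))).indicator 1
        ((couplingCode hP).queryAt f (Fin.last t) (x, s)))
      (hm.comp measurable_prodMk_left)).trans ((lintegral_congr fun s => ?_).trans lintegral_zero)
    refine (lintegral_coin (flagProb P t x f s) _).trans ?_
    rw [flagProb_of_last_on x hf]
    simp [queryAt_last]
  filter_upwards [(lintegral_eq_zero_iff hm).1 h0] with z hz
  simpa using hz

lemma law_inter_query_of_off (hπ : ∀ x, 0 ≤ π₀ x) (hP1 : ∀ x, ∑ y, P x y = 1) {t : ℕ}
    {f : Fin (t + 2) → Status} (hf : f (Fin.last (t + 1)) = OFF)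
    {E : Set ((Fin (t + 1) → Fin 2) × (Fin (t + 1) → Bool))} (hE : MeasurableSet E)
    {q₀ : Option (Fin 2)}
    (hq₀ : ∀ ω ∈ E, (couplingCode hP).queryAt (Fin.init f) (Fin.last t) ω = q₀)
    (q : Option (Fin 2)) :
    (couplingCode hP).law π₀ P f
        (forgetLast ⁻¹' E ∩ (couplingCode hP).queryAt f (Fin.last (t + 1)) ⁻¹' {q}) =
      (couplingCode hP).law π₀ P (Fin.init f) E * queryStep P q₀ q := by
  have h := lintegral_law_succ_of_off hP hπ hP1 hf (measurable_one.indicator hE) q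
  have hV : MeasurableSet ((couplingCode hP).queryAt f (Fin.last (t + 1)) ⁻¹' {q}) :=
    (couplingCode hP).measurable_queryAt f _ (measurableSet_singleton q)
  have hE' : MeasurableSet (forgetLast ⁻¹' E : Set ((Fin (t + 2) → Fin 2) × _)) :=
    (couplingCode hP).measurable_forgetLast hE
  rw [← lintegral_indicator_one (hE'.inter hV)]
  refine Eq.trans (lintegral_congr fun z => ?_) (h.trans ?_)
  · rw [Set.inter_indicator_one]
    rfl
  · rw [mul_comm, ← lintegral_indicator_const hE]
    refine lintegral_congr fun z => ?_
    by_cases hz : z ∈ E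
    · simp [hz, hq₀ z hz]
    · simp [hz]

lemma isPrivate (hπ : ∀ x, 0 ≤ π₀ x) (hπ1 : ∑ x, π₀ x = 1) (hP1 : ∀ x, ∑ y, P x y = 1) {t : ℕ}
    {f : Fin (t + 1) → Status} (hf0 : f 0 = ON) : (couplingCode hP).Private π₀ P f := by
  have := (couplingCode hP).isProbabilityMeasure_law hπ hπ1 hP hP1 f
  rw [Code.private_iff]
  intro z u q
  cases hf : f (Fin.last t) with
  | true =>
    have hae := ae_queryAt_eq_none_of_on hP π₀ hf
    cases q with
    | none =>
      have hE : ∀ E, (couplingCode hP).law π₀ P f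
          (E ∩ (couplingCode hP).queryAt f (Fin.last t) ⁻¹' {none}) =
            (couplingCode hP).law π₀ P f E := fun E =>
        measure_congr (by
          filter_upwards [hae] with ω hω
          exact propext ⟨fun h => h.1, fun h => ⟨h, hω⟩⟩)
      rw [← Set.inter_assoc, hE, hE, mul_comm]
    | some y =>
      have h0 : (couplingCode hP).law π₀ P f
          ((couplingCode hP).queryAt f (Fin.last t) ⁻¹' {some y}) = 0 := by
        rw [measure_eq_zero_iff_ae_notMem]
        filter_upwards [hae] with ω hω
        simp [hω]
      rw [measure_mono_null (Set.inter_subset_right.trans Set.inter_subset_right) h0,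
        measure_mono_null Set.inter_subset_right h0, mul_zero, mul_zero]
  | false =>
    cases t with
    | zero => exact absurd (hf0.symm.trans hf) (by decide)
    | succ t =>
      -- the current request is not private, so only the event about `Q_t` involves time `t + 1`
      let E := (couplingCode hP).queries (Fin.init f) ⁻¹' {z}
      let D : Set ((Fin (t + 1) → Fin 2) × (Fin (t + 1) → Bool)) :=
        {ω | (couplingCode hP).privateRequests f (Fin.snoc (α := fun _ => Fin 2) ω.1 0,
          Fin.snoc (α := fun _ => Bool) ω.2 false) = u}
      have hE : MeasurableSet E :=
        (couplingCode hP).measurable_queries (Fin.init f) (measurableSet_singleton z)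
      have hD : MeasurableSet D := by
        have : Measurable fun ω : (Fin (t + 1) → Fin 2) × (Fin (t + 1) → Bool) =>
            (couplingCode hP).privateRequests f (Fin.snoc (α := fun _ => Fin 2) ω.1 0,
              Fin.snoc (α := fun _ => Bool) ω.2 false) := Measurable.of_discrete
        exact this (measurableSet_singleton u)
      have hEeq : (couplingCode hP).pastQueries f ⁻¹' {z} = forgetLast ⁻¹' E := rfl
      have hDeq : (couplingCode hP).privateRequests f ⁻¹' {u} = forgetLast ⁻¹' D := by
        ext ω
        have : (couplingCode hP).privateRequests f ω = (couplingCode hP).privateRequests f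
            (Fin.snoc (α := fun _ => Fin 2) (forgetLast ω).1 0,
              Fin.snoc (α := fun _ => Bool) (forgetLast ω).2 false) := by
          funext i
          obtain ⟨i, hi⟩ := i
          rw [mem_onTimes] at hi
          induction i using Fin.lastCases with
          | last => exact absurd (hi.symm.trans hf) (by decide)
          | cast i => simp [Code.privateRequests, forgetLast, Fin.init]
        simp only [Set.mem_preimage, Set.mem_singleton_iff, this]
        rfl
      have hlast : ∀ ω ∈ E, (couplingCode hP).queryAt (Fin.init f) (Fin.last t) ω =
          z (Fin.last t) := fun ω hω => congrFun hω (Fin.last t)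
      rw [hEeq, hDeq, ← Set.inter_assoc, ← Set.preimage_inter,
        law_inter_query_of_off hP hπ hP1 hf (hE.inter hD) (fun ω hω => hlast ω hω.1),
        law_inter_query_of_off hP hπ hP1 hf hE hlast,
        (couplingCode hP).law_preimage_forgetLast hπ hP hP1 f hE,
        (couplingCode hP).law_preimage_forgetLast hπ hP hP1 f (hE.inter hD)]
      ring

lemma law_queryAt_eq_none (hπ : ∀ x, 0 ≤ π₀ x) (hπ1 : ∑ x, π₀ x = 1)
    (hP1 : ∀ x, ∑ y, P x y = 1) : ∀ {t : ℕ} {f : Fin (t + 1) → Status}, f 0 = ON →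
    (couplingCode hP).law π₀ P f ((couplingCode hP).queryAt f (Fin.last t) ⁻¹' {none}) =
      ENNReal.ofReal (|P 0 0 - P 1 0| ^ (t - lastOn f)) := by
  have hon : ∀ {t : ℕ} {f : Fin (t + 1) → Status}, f (Fin.last t) = ON →
      (couplingCode hP).law π₀ P f ((couplingCode hP).queryAt f (Fin.last t) ⁻¹' {none}) =
        ENNReal.ofReal (|P 0 0 - P 1 0| ^ (t - lastOn f)) := by
    intro t f hf
    have := (couplingCode hP).isProbabilityMeasure_law hπ hπ1 hP hP1 f
    rw [lastOn_of_last_on hf, Nat.sub_self, pow_zero, ENNReal.ofReal_one,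
      ← measure_univ (μ := (couplingCode hP).law π₀ P f)]
    refine measure_congr ?_
    filter_upwards [ae_queryAt_eq_none_of_on hP π₀ hf] with ω hω
    exact propext ⟨fun _ => trivial, fun _ => hω⟩
  intro t
  induction t with
  | zero => exact fun hf0 => hon hf0
  | succ t ih =>
    intro f hf0
    cases hf : f (Fin.last (t + 1)) with
    | true => exact hon hf
    | false =>
      have hE : MeasurableSet
          ((couplingCode hP).queryAt (Fin.init f) (Fin.last t) ⁻¹' {none}) :=
        (couplingCode hP).measurable_queryAt _ _ (measurableSet_singleton _)
      have h := lintegral_law_succ_of_off hP hπ hP1 hf (g := 1) measurable_one none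
      have hV : MeasurableSet ((couplingCode hP).queryAt f (Fin.last (t + 1)) ⁻¹' {none}) :=
        (couplingCode hP).measurable_queryAt f _ (measurableSet_singleton _)
      rw [← lintegral_indicator_one hV]
      refine Eq.trans (lintegral_congr fun z => ?_) (h.trans ?_)
      · rw [Pi.one_apply, one_mul]
        rfl
      · have hle : lastOn (Fin.init f : Fin (t + 1) → Status) ≤ t := lastOn_le _
        rw [lastOn_of_last_off hf, Nat.succ_sub hle, pow_succ', ENNReal.ofReal_mul (abs_nonneg _),
          ← ih (f := Fin.init f) hf0, ← lintegral_indicator_const hE]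
        refine lintegral_congr fun z => ?_
        rw [Pi.one_apply, one_mul]
        cases hq : (couplingCode hP).queryAt (Fin.init f) (Fin.last t) z with
        | none => simp [hq, queryStep]
        | some x => simp [hq, queryStep]

lemma avgLen_eq (hπ : ∀ x, 0 ≤ π₀ x) (hπ1 : ∑ x, π₀ x = 1)
    (hP1 : ∀ x, ∑ y, P x y = 1) {t : ℕ} {f : Fin (t + 1) → Status} (hf0 : f 0 = ON) :
    (couplingCode hP).avgLen π₀ P f = 1 + |P 0 0 - P 1 0| ^ (t - lastOn f) := by
  have := (couplingCode hP).isProbabilityMeasure_law hπ hπ1 hP hP1 f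
  have hV : MeasurableSet ((couplingCode hP).queryAt f (Fin.last t) ⁻¹' {none}) :=
    (couplingCode hP).measurable_queryAt f _ (measurableSet_singleton _)
  have hlen : ∀ z, ((couplingCode hP).len ((couplingCode hP).queryAt f (Fin.last t) z) : ℝ) =
      1 + ((couplingCode hP).queryAt f (Fin.last t) ⁻¹' {none}).indicator 1 z := by
    intro z
    cases hq : (couplingCode hP).queryAt f (Fin.last t) z with
    | none => simp [hq]; norm_num
    | some x => simp [hq]
  rw [Code.avgLen, integral_congr_ae (Filter.Eventually.of_forall hlen),
    integral_add (integrable_const _) ((integrable_const _).indicator hV),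
    integral_indicator_one hV, measureReal_def, law_queryAt_eq_none hP hπ hπ1 hP1 hf0,
    ENNReal.toReal_ofReal (by positivity)]
  simp

end couplingCode

/-- Achievability: the coupling scheme is private and has the required average length. -/
lemma achievable_of_le {π₀ : Fin 2 → ℝ} (hπ : ∀ x, 0 ≤ π₀ x) (hπ1 : ∑ x, π₀ x = 1)
    (hP : ∀ x y, 0 ≤ P x y) (hP1 : ∀ x, ∑ y, P x y = 1)
    {ν : Measure (ℕ → Status)} (hν : ∀ᵐ F ∂ν, F 0 = ON)
    {R : (t : ℕ) → (Fin (t + 1) → Status) → ℝ}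
    (hR : ∀ (t : ℕ) (f : Fin (t + 1) → Status), Possible ν f → 0 < R t f)
    (h : ∀ (t : ℕ) (f : Fin (t + 1) → Status), Possible ν f →
      1 / R t f ≥ 1 + |P 0 0 - P 1 0| ^ (t - lastOn f)) : Achievable π₀ P ν R := by
  refine ⟨1, one_pos, couplingCode hP, fun t f hf => ?_⟩
  have hf0 := hf.zero_on hν
  refine ⟨couplingCode.decodable hP π₀ f, couplingCode.isPrivate hP hπ hπ1 hP1 hf0, ?_⟩
  have hpos : 0 < 1 + |P 0 0 - P 1 0| ^ (t - lastOn f) := by positivity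
  rw [couplingCode.avgLen_eq hP hπ hπ1 hP1 hf0, Nat.cast_one]
  exact (le_one_div hpos (hR t f hf)).1 (h t f hf)

end Coupling

/-! ### Integrals over the fibres of a discrete variable -/

lemma lintegral_mul_comp_eq_sum {Ω A : Type*} [MeasurableSpace Ω] [Fintype A] [MeasurableSpace A]
    [MeasurableSingletonClass A] (μ : Measure Ω) {g : Ω → ℝ≥0∞} (hg : Measurable g) {X : Ω → A}
    (hX : Measurable X) (φ : A → ℝ≥0∞) :
    ∫⁻ ω, g ω * φ (X ω) ∂μ = ∑ a, φ a * ∫⁻ ω in X ⁻¹' {a}, g ω ∂μ := by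
  classical
  have hm : ∀ a, MeasurableSet (X ⁻¹' {a}) := fun a => hX (measurableSet_singleton a)
  simp_rw [← lintegral_indicator (hm _)]
  simp_rw [← lintegral_const_mul _ (hg.indicator (hm _))]
  rw [← lintegral_finsetSum _ fun a _ => (hg.indicator (hm a)).const_mul _]
  refine lintegral_congr fun ω => ?_
  simp [Set.indicator_apply, mul_comm]

lemma setLIntegral_comp_eq_sum {Ω A : Type*} [MeasurableSpace Ω] [Fintype A] [MeasurableSpace A]
    [MeasurableSingletonClass A] (μ : Measure Ω) (E : Set Ω) {X : Ω → A}
    (hX : Measurable X) (φ : A → ℝ≥0∞) :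
    ∫⁻ ω in E, φ (X ω) ∂μ = ∑ a, φ a * μ (E ∩ X ⁻¹' {a}) := by
  have h := lintegral_mul_comp_eq_sum (μ.restrict E) measurable_one hX φ
  simp only [Pi.one_apply, one_mul, lintegral_one, Measure.restrict_apply_univ,
    Measure.restrict_apply (hX (measurableSet_singleton _))] at h
  simpa only [Set.inter_comm] using h

lemma map_withDensity_eq_map {Ω A : Type*} [MeasurableSpace Ω] [Countable A] [MeasurableSpace A]
    [MeasurableSingletonClass A] {μ : Measure Ω} {θ : Ω → ℝ≥0∞} {V : Ω → A} (hV : Measurable V)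
    (h : ∀ a, ∫⁻ ω in V ⁻¹' {a}, θ ω ∂μ = μ (V ⁻¹' {a})) :
    (μ.withDensity θ).map V = μ.map V := by
  refine Measure.ext_of_singleton fun a => ?_
  rw [Measure.map_apply hV (measurableSet_singleton a),
    Measure.map_apply hV (measurableSet_singleton a),
    withDensity_apply _ (hV (measurableSet_singleton a)), h]

namespace Code

variable {L : ℕ} (c : Code 2 L) {π₀ : Fin 2 → ℝ} {P : Matrix (Fin 2) (Fin 2) ℝ}

/-! ### The length of an answer -/

/-- If a query occurs together with a request of `y`, then its answer determines message `y`. -/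
lemma exists_decoder {t : ℕ} {f : Fin (t + 1) → Status} [IsFiniteMeasure (c.law π₀ P f)]
    (hd : c.Decodable π₀ P f) {q : c.Q} {y : Fin 2}
    (h : c.law π₀ P f (c.queryAt f (Fin.last t) ⁻¹' {q} ∩ {z | z.1 (Fin.last t) = y}) ≠ 0) :
    ∃ d : (Fin (c.len q) → Bool) → Fin L → Bool, ∀ w, d (c.answer t q w) = w y := by
  obtain ⟨z, ⟨hzq, hzy⟩, hz⟩ :=
    Measure.exists_mem_of_measure_ne_zero_of_ae h (ae_restrict_of_ae (Measure.ae_ae_of_ae_prod hd))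
  simp only [Set.mem_preimage, Set.mem_singleton_iff, Set.mem_ofPred_eq] at hzq hzy
  subst hzq hzy
  refine ⟨fun a => c.decode t _ a (z.1 (Fin.last t)) (z.2 (Fin.last t)), fun w => ?_⟩
  by_contra hw
  have h0 : (PMF.uniformOfFintype (Fin 2 → Fin L → Bool)).toMeasure {w} = 0 :=
    measure_mono_null (by rintro _ rfl; exact hw) hz
  rw [PMF.toMeasure_apply_singleton _ _ (measurableSet_singleton w)] at h0
  simp at h0

lemma le_len_of_decoder {t : ℕ} {q : c.Q} {y : Fin 2}
    (h : ∃ d : (Fin (c.len q) → Bool) → Fin L → Bool, ∀ w, d (c.answer t q w) = w y) :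
    L ≤ c.len q := by
  obtain ⟨d, hd⟩ := h
  have := Fintype.card_le_of_surjective d fun v => ⟨_, hd fun _ => v⟩
  simpa [Nat.pow_le_pow_iff_right] using this

lemma two_mul_le_len_of_decoders {t : ℕ} {q : c.Q}
    (h : ∀ y, ∃ d : (Fin (c.len q) → Bool) → Fin L → Bool, ∀ w, d (c.answer t q w) = w y) :
    L * 2 ≤ c.len q := by
  choose d hd using h
  have hinj : Function.Injective (c.answer t q) := fun w w' hw => by
    funext y
    rw [← hd y w, ← hd y w', hw]
  have := Fintype.card_le_of_injective _ hinj
  simpa [← pow_mul, Nat.pow_le_pow_iff_right] using this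

/-! ### Tilting the law towards a value of the last private request -/

/-- Given the past queries, the current query is independent of every function of the private
requests. -/
lemma lintegral_of_private {t : ℕ} {f : Fin (t + 1) → Status} [IsFiniteMeasure (c.law π₀ P f)]
    (hp : c.Private π₀ P f) (z : Fin t → c.Q) (q : c.Q) (h : (onTimes f → Fin 2) → ℝ≥0∞) :
    c.law π₀ P f (c.pastQueries f ⁻¹' {z}) *
        ∫⁻ ω in c.pastQueries f ⁻¹' {z} ∩ c.queryAt f (Fin.last t) ⁻¹' {q},
          h (c.privateRequests f ω) ∂(c.law π₀ P f) =
      c.law π₀ P f (c.pastQueries f ⁻¹' {z} ∩ c.queryAt f (Fin.last t) ⁻¹' {q}) *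
        ∫⁻ ω in c.pastQueries f ⁻¹' {z}, h (c.privateRequests f ω) ∂(c.law π₀ P f) := by
  rw [private_iff] at hp
  rw [setLIntegral_comp_eq_sum _ _ (c.measurable_privateRequests f),
    setLIntegral_comp_eq_sum _ _ (c.measurable_privateRequests f), Finset.mul_sum, Finset.mul_sum]
  refine Finset.sum_congr rfl fun u _ => ?_
  have := hp z u q
  rw [Set.inter_assoc, Set.inter_comm (c.queryAt f _ ⁻¹' _), mul_left_comm, this]
  ring

lemma queries_preimage {t : ℕ} (f : Fin (t + 1) → Status) (q : Fin (t + 1) → c.Q) :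
    c.queries f ⁻¹' {q} =
      c.pastQueries f ⁻¹' {Fin.init q} ∩ c.queryAt f (Fin.last t) ⁻¹' {q (Fin.last t)} := by
  ext z
  simp only [Set.mem_preimage, Set.mem_singleton_iff, Set.mem_inter_iff]
  constructor
  · rintro rfl
    exact ⟨rfl, rfl⟩
  · rintro ⟨h1, h2⟩
    funext i
    induction i using Fin.lastCases with
    | last => exact h2
    | cast i => exact congrFun h1 i

/-- The density `h`, evaluated at the queries and the private requests. -/
def tilt {t : ℕ} (f : Fin (t + 1) → Status)
    (h : (Fin (t + 1) → c.Q) → (onTimes f → Fin 2) → ℝ≥0∞)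
    (z : (Fin (t + 1) → Fin 2) × (Fin (t + 1) → c.S)) : ℝ≥0∞ :=
  h (c.queries f z) (c.privateRequests f z)

lemma measurable_tilt {t : ℕ} (f : Fin (t + 1) → Status)
    (h : (Fin (t + 1) → c.Q) → (onTimes f → Fin 2) → ℝ≥0∞) : Measurable (c.tilt f h) :=
  (Measurable.of_discrete (f := fun p : (Fin (t + 1) → c.Q) × (onTimes f → Fin 2) => h p.1 p.2)).comp
    ((c.measurable_queries f).prodMk (c.measurable_privateRequests f))

/-- For each value `x` of the last private request, there is a density which depends only on the
queries and the private requests, does not change the law of the queries, and under which the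
current request is distributed as `t - τ` steps of the chain after `x`. Only the difference of the
two laws of the current request is recorded. -/
def HasTilts (π₀ : Fin 2 → ℝ) (P : Matrix (Fin 2) (Fin 2) ℝ) {t : ℕ}
    (f : Fin (t + 1) → Status) : Prop :=
  ∃ (h : Fin 2 → (Fin (t + 1) → c.Q) → (onTimes f → Fin 2) → ℝ≥0∞) (p : Fin 2 → Fin 2 → ℝ),
    (∀ x y, 0 ≤ p x y) ∧ (∀ x, p x 0 + p x 1 = 1) ∧
    p 0 0 - p 1 0 = (P 0 0 - P 1 0) ^ (t - lastOn f) ∧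
    (∀ x q, ∫⁻ z in c.queries f ⁻¹' {q}, c.tilt f (h x) z ∂(c.law π₀ P f) =
      c.law π₀ P f (c.queries f ⁻¹' {q})) ∧
    ∀ x y, ∫⁻ z in {z | z.1 (Fin.last t) = y}, c.tilt f (h x) z ∂(c.law π₀ P f) =
      ENNReal.ofReal (p x y)

/-- The past queries never rule out a value of the current request. -/
def FullSupport (π₀ : Fin 2 → ℝ) (P : Matrix (Fin 2) (Fin 2) ℝ) {t : ℕ}
    (f : Fin (t + 1) → Status) : Prop :=
  ∀ z, c.law π₀ P f (c.pastQueries f ⁻¹' {z}) ≠ 0 → ∀ x,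
    c.law π₀ P f (c.pastQueries f ⁻¹' {z} ∩ {ω | ω.1 (Fin.last t) = x}) ≠ 0

/-- When privacy is ON, the tilting is conditioning the current request to be `x`, separately for
each value of the past queries. -/
lemma hasTilts_of_on {t : ℕ} {f : Fin (t + 1) → Status} [IsProbabilityMeasure (c.law π₀ P f)]
    (hf : f (Fin.last t) = ON) (hp : c.Private π₀ P f) (hs : c.FullSupport π₀ P f) :
    c.HasTilts π₀ P f := by
  let h : Fin 2 → (Fin (t + 1) → c.Q) → (onTimes f → Fin 2) → ℝ≥0∞ := fun x q u =>
    if u ⟨Fin.last t, mem_onTimes.2 hf⟩ = x then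
      c.law π₀ P f (c.pastQueries f ⁻¹' {Fin.init q}) /
        c.law π₀ P f (c.pastQueries f ⁻¹' {Fin.init q} ∩ {ω | ω.1 (Fin.last t) = x})
    else 0
  have hX : ∀ x, MeasurableSet
      {ω : (Fin (t + 1) → Fin 2) × (Fin (t + 1) → c.S) | ω.1 (Fin.last t) = x} := fun x =>
    c.measurable_request (Fin.last t) (measurableSet_singleton x)
  have hq : ∀ x q, ∫⁻ z in c.queries f ⁻¹' {q}, c.tilt f (h x) z ∂(c.law π₀ P f) =
      c.law π₀ P f (c.queries f ⁻¹' {q}) := by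
    intro x q
    have hmem : MeasurableSet (c.queries f ⁻¹' {q}) :=
      c.measurable_queries f (measurableSet_singleton q)
    rw [setLIntegral_congr_fun (g := fun z => h x q (c.privateRequests f z)) hmem
      fun z hz => by
        rw [tilt, show c.queries f z = q from hz]]
    rw [queries_preimage]
    by_cases h0 : c.law π₀ P f (c.pastQueries f ⁻¹' {Fin.init q}) = 0
    · have h1 := measure_mono_null (Set.inter_subset_left
        (t := c.queryAt f (Fin.last t) ⁻¹' {q (Fin.last t)})) h0
      rw [h1, setLIntegral_measure_zero _ _ h1]
    have hpr := c.lintegral_of_private hp (Fin.init q) (q (Fin.last t)) (h x q)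
    have htot : ∫⁻ ω in c.pastQueries f ⁻¹' {Fin.init q}, h x q (c.privateRequests f ω)
        ∂(c.law π₀ P f) = c.law π₀ P f (c.pastQueries f ⁻¹' {Fin.init q}) := by
      have hind : ∀ ω, h x q (c.privateRequests f ω) =
          {ω : (Fin (t + 1) → Fin 2) × (Fin (t + 1) → c.S) | ω.1 (Fin.last t) = x}.indicator
            (fun _ => c.law π₀ P f (c.pastQueries f ⁻¹' {Fin.init q}) /
              c.law π₀ P f (c.pastQueries f ⁻¹' {Fin.init q} ∩ {ω | ω.1 (Fin.last t) = x})) ω := by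
        intro ω
        classical
        rw [Set.indicator_apply]
        rfl
      simp_rw [hind]
      rw [lintegral_indicator_const (hX x), Measure.restrict_apply (hX x),
        Set.inter_comm {ω | _}, ENNReal.div_mul_cancel (hs _ h0 x) (measure_ne_top _ _)]
    rw [htot, mul_comm] at hpr
    exact (ENNReal.mul_left_inj h0 (measure_ne_top _ _)).1 hpr
  refine ⟨h, fun x y => if x = y then 1 else 0, fun x y => by dsimp only; split_ifs <;> norm_num,
    fun x => by fin_cases x <;> simp, by simp [lastOn_of_last_on hf], hq, fun x y => ?_⟩
  have hne : ∀ y, x ≠ y →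
      ∫⁻ z in {z | z.1 (Fin.last t) = y}, c.tilt f (h x) z ∂(c.law π₀ P f) = 0 := by
    intro y hxy
    rw [setLIntegral_congr_fun (g := 0) (hX y) fun z hz => ?_]
    · simp
    · exact if_neg fun h => hxy (h.symm.trans hz)
  by_cases hxy : x = y
  · subst hxy
    have htot : ∫⁻ z, c.tilt f (h x) z ∂(c.law π₀ P f) = 1 := by
      have hmap := congrArg (fun m => m Set.univ)
        (map_withDensity_eq_map (c.measurable_queries f) (hq x))
      simpa [Measure.map_apply (c.measurable_queries f) MeasurableSet.univ] using hmap
    rw [← lintegral_add_compl _ (hX x)] at htot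
    have hc : ∫⁻ z in {z | z.1 (Fin.last t) = x}ᶜ, c.tilt f (h x) z ∂(c.law π₀ P f) = 0 := by
      rw [setLIntegral_congr_fun (g := 0) (hX x).compl fun z hz => ?_]
      · simp
      · exact if_neg fun h => hz h
    rw [hc, add_zero] at htot
    simp [htot]
  · simp [hne y hxy, hxy]

/-- While privacy is OFF, the densities of the previous time keep their properties: the new query
does not depend on the private requests, and the new request is a step of the chain. -/
lemma hasTilts_of_off (hπ : ∀ x, 0 ≤ π₀ x) (hP : ∀ x y, 0 ≤ P x y) (hP1 : ∀ x, ∑ y, P x y = 1)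
    {t : ℕ} {f : Fin (t + 2) → Status} [IsProbabilityMeasure (c.law π₀ P f)]
    (hf : f (Fin.last (t + 1)) = OFF) (hp : c.Private π₀ P f)
    (ht : c.HasTilts π₀ P (Fin.init f : Fin (t + 1) → Status)) : c.HasTilts π₀ P f := by
  obtain ⟨h, p, hp0, hp1, hpd, hq, hX⟩ := ht
  let res : (onTimes f → Fin 2) → onTimes (Fin.init f : Fin (t + 1) → Status) → Fin 2 :=
    fun u i => u ⟨i.1.castSucc,
      mem_onTimes.2 (mem_onTimes (f := (Fin.init f : Fin (t + 1) → Status)).1 i.2)⟩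
  have htilt : ∀ x z, c.tilt f (fun q u => h x (Fin.init q) (res u)) z =
      c.tilt (Fin.init f) (h x) (forgetLast z) := fun x z => rfl
  refine ⟨fun x q u => h x (Fin.init q) (res u), fun x y => ∑ x', p x x' * P x' y,
    fun x y => Finset.sum_nonneg fun x' _ => mul_nonneg (hp0 _ _) (hP _ _), fun x => ?_, ?_,
    fun x q => ?_, fun x y => ?_⟩
  · have h0 := hP1 0
    have h1 := hP1 1
    simp only [Fin.sum_univ_two] at h0 h1 ⊢
    linear_combination p x 0 * h0 + p x 1 * h1 + hp1 x
  · rw [lastOn_of_last_off hf, Nat.succ_sub (lastOn_le _), pow_succ, ← hpd]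
    simp only [Fin.sum_univ_two]
    linear_combination P 1 0 * (hp1 0 - hp1 1)
  · have hmem : MeasurableSet (c.queries f ⁻¹' {q}) :=
      c.measurable_queries f (measurableSet_singleton q)
    rw [setLIntegral_congr_fun
      (g := fun z => h x (Fin.init q) (res (c.privateRequests f z))) hmem
      fun z hz => by rw [tilt, show c.queries f z = q from hz]]
    rw [queries_preimage]
    by_cases h0 : c.law π₀ P f (c.pastQueries f ⁻¹' {Fin.init q}) = 0
    · have h1 := measure_mono_null (Set.inter_subset_left
        (t := c.queryAt f (Fin.last (t + 1)) ⁻¹' {q (Fin.last (t + 1))})) h0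
      rw [h1, setLIntegral_measure_zero _ _ h1]
    have hpr := c.lintegral_of_private hp (Fin.init q) (q (Fin.last (t + 1)))
      fun u => h x (Fin.init q) (res u)
    have hE : MeasurableSet (c.queries (Fin.init f) ⁻¹' {Fin.init q}) :=
      c.measurable_queries _ (measurableSet_singleton _)
    have hE' : MeasurableSet (c.pastQueries f ⁻¹' {Fin.init q}) :=
      c.measurable_pastQueries _ (measurableSet_singleton _)
    have htot : ∫⁻ ω in c.pastQueries f ⁻¹' {Fin.init q},
        h x (Fin.init q) (res (c.privateRequests f ω)) ∂(c.law π₀ P f) =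
          c.law π₀ P f (c.pastQueries f ⁻¹' {Fin.init q}) := by
      have h2 := hq x (Fin.init q)
      rw [← c.law_preimage_forgetLast hπ hP hP1 f hE, ← lintegral_indicator hE,
        ← c.lintegral_law_forgetLast hπ hP hP1 f ((c.measurable_tilt _ _).indicator hE)] at h2
      refine Eq.trans ?_ h2
      rw [← lintegral_indicator hE']
      refine lintegral_congr fun ω => ?_
      by_cases hω : c.pastQueries f ω = Fin.init q
      · rw [Set.indicator_of_mem (s := c.pastQueries f ⁻¹' {Fin.init q}) hω,
          Set.indicator_of_mem (s := c.queries (Fin.init f) ⁻¹' {Fin.init q}) hω, tilt, ← pastQueries_eq_queries_init, hω]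
        rfl
      · rw [Set.indicator_of_notMem (s := c.pastQueries f ⁻¹' {Fin.init q}) hω,
          Set.indicator_of_notMem (s := c.queries (Fin.init f) ⁻¹' {Fin.init q}) hω]
    rw [htot, mul_comm] at hpr
    exact (ENNReal.mul_left_inj h0 (measure_ne_top _ _)).1 hpr
  · have hXm : MeasurableSet
        {ω : (Fin (t + 2) → Fin 2) × (Fin (t + 2) → c.S) | ω.1 (Fin.last (t + 1)) = y} :=
      c.measurable_request (Fin.last (t + 1)) (measurableSet_singleton y)
    have hstep := c.lintegral_law_succ_request hπ hP f (c.measurable_tilt (Fin.init f) (h x))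
      (({y} : Set (Fin 2)).indicator 1)
    rw [lintegral_mul_comp_eq_sum _ (c.measurable_tilt (Fin.init f) (h x))
      (c.measurable_request (Fin.last t))
      (fun x' => ∑ y', ENNReal.ofReal (P x' y') * ({y} : Set (Fin 2)).indicator 1 y')] at hstep
    rw [← lintegral_indicator hXm]
    refine Eq.trans (lintegral_congr fun z => ?_) (hstep.trans ?_)
    · classical
      rw [Set.indicator_apply, Set.indicator_apply]
      by_cases hz : z.1 (Fin.last (t + 1)) = y
      · simp [hz, htilt]
      · simp [hz]
    · rw [ENNReal.ofReal_sum_of_nonneg fun x' _ => mul_nonneg (hp0 _ _) (hP _ _)]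
      refine Finset.sum_congr rfl fun x' _ => ?_
      have := hX x x'
      rw [ENNReal.ofReal_mul (hp0 _ _), ← this, mul_comm]
      congr 1
      classical
      simp [Set.indicator_apply]

/-! ### The support of the current request given the queries -/

lemma law_inter_request (hπ : ∀ x, 0 ≤ π₀ x) (hP : ∀ x y, 0 ≤ P x y) {t : ℕ}
    (f : Fin (t + 2) → Status) {E : Set ((Fin (t + 1) → Fin 2) × (Fin (t + 1) → c.S))}
    (hE : MeasurableSet E) (y : Fin 2) :
    c.law π₀ P f (forgetLast ⁻¹' E ∩ {z | z.1 (Fin.last (t + 1)) = y}) =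
      ∑ x, ENNReal.ofReal (P x y) *
        c.law π₀ P (Fin.init f) (E ∩ {z | z.1 (Fin.last t) = x}) := by
  have hX : MeasurableSet
      {ω : (Fin (t + 2) → Fin 2) × (Fin (t + 2) → c.S) | ω.1 (Fin.last (t + 1)) = y} :=
    c.measurable_request (Fin.last (t + 1)) (measurableSet_singleton y)
  have hstep := c.lintegral_law_succ_request hπ hP f (measurable_one.indicator hE)
    (({y} : Set (Fin 2)).indicator 1)
  rw [lintegral_mul_comp_eq_sum _ (measurable_one.indicator hE) (c.measurable_request (Fin.last t))
    (fun x => ∑ y', ENNReal.ofReal (P x y') * ({y} : Set (Fin 2)).indicator 1 y')] at hstep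
  rw [← lintegral_indicator_one ((c.measurable_forgetLast hE).inter hX)]
  refine Eq.trans (lintegral_congr fun z => ?_) (hstep.trans (Finset.sum_congr rfl fun x _ => ?_))
  · rw [Set.inter_indicator_one]
    rfl
  · rw [lintegral_indicator_one hE, Measure.restrict_apply hE]
    congr 1
    classical
    simp [Set.indicator_apply]

/-- Neither the past queries nor the current one rule out a value of the current request. -/
def FullSupportAfter (π₀ : Fin 2 → ℝ) (P : Matrix (Fin 2) (Fin 2) ℝ) {t : ℕ}
    (f : Fin (t + 1) → Status) : Prop :=
  ∀ q, c.law π₀ P f (c.queries f ⁻¹' {q}) ≠ 0 → ∀ x,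
    c.law π₀ P f (c.queries f ⁻¹' {q} ∩ {ω | ω.1 (Fin.last t) = x}) ≠ 0

lemma law_request_zero_ne_zero (hπ : ∀ x, 0 < π₀ x) (f : Fin 1 → Status) (x : Fin 2) :
    c.law π₀ P f {z | z.1 0 = x} ≠ 0 := by
  have hX : MeasurableSet {ω : (Fin 1 → Fin 2) × (Fin 1 → c.S) | ω.1 0 = x} :=
    c.measurable_request (0 : Fin 1) (measurableSet_singleton x)
  rw [← lintegral_indicator_one hX, c.lintegral_law _ _ _ (measurable_one.indicator hX)]
  intro h
  have h1 := (Finset.sum_eq_zero_iff.1 h) (fun _ => x) (Finset.mem_univ _)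
  have h2 : π₀ x ≤ 0 := by simpa [pathProb] using h1
  exact absurd h2 (not_le.2 (hπ x))

lemma fullSupport_zero (hπ : ∀ x, 0 < π₀ x) (f : Fin 1 → Status) : c.FullSupport π₀ P f := by
  intro z _ x
  have : c.pastQueries f ⁻¹' {z} = Set.univ :=
    Set.eq_univ_of_forall fun ω => Subsingleton.elim (α := Fin 0 → c.Q) _ _
  rw [this, Set.univ_inter]
  exact c.law_request_zero_ne_zero hπ f x

/-- If all transitions are possible, no value of the next request can be ruled out. -/
lemma fullSupport_succ_of_pos (hπ : ∀ x, 0 ≤ π₀ x) (hP : ∀ x y, 0 < P x y)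
    (hP1 : ∀ x, ∑ y, P x y = 1) {t : ℕ} (f : Fin (t + 2) → Status) : c.FullSupport π₀ P f := by
  intro z hz y
  have hE : MeasurableSet (c.queries (Fin.init f) ⁻¹' {z}) :=
    c.measurable_queries _ (measurableSet_singleton z)
  have hEeq : c.pastQueries f ⁻¹' {z} = forgetLast ⁻¹' (c.queries (Fin.init f) ⁻¹' {z}) := rfl
  rw [hEeq, c.law_preimage_forgetLast hπ (fun x y => (hP x y).le) hP1 f hE] at hz
  rw [hEeq, c.law_inter_request hπ (fun x y => (hP x y).le) f hE]
  contrapose! hz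
  refine measure_mono_null (t := ⋃ x : Fin 2, c.queries (Fin.init f) ⁻¹' {z} ∩
    {ω | ω.1 (Fin.last t) = x}) (fun ω hω => Set.mem_iUnion.2 ⟨_, hω, rfl⟩)
    (measure_iUnion_null fun x => ?_)
  have := (Finset.sum_eq_zero_iff.1 hz) x (Finset.mem_univ _)
  simpa [(hP x y).not_ge] using this

/-- Full support survives a step of a chain in which every value can be reached. -/
lemma fullSupport_succ (hπ : ∀ x, 0 ≤ π₀ x) (hP : ∀ x y, 0 ≤ P x y)
    (hP1 : ∀ x, ∑ y, P x y = 1) (hcol : ∀ y, ∃ x, 0 < P x y) {t : ℕ} {f : Fin (t + 2) → Status}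
    (hs : c.FullSupportAfter π₀ P (Fin.init f : Fin (t + 1) → Status)) :
    c.FullSupport π₀ P f := by
  intro z hz y
  have hE : MeasurableSet (c.queries (Fin.init f) ⁻¹' {z}) :=
    c.measurable_queries _ (measurableSet_singleton z)
  have hEeq : c.pastQueries f ⁻¹' {z} = forgetLast ⁻¹' (c.queries (Fin.init f) ⁻¹' {z}) := rfl
  rw [hEeq, c.law_preimage_forgetLast hπ hP hP1 f hE] at hz
  rw [hEeq, c.law_inter_request hπ hP f hE]
  obtain ⟨x, hx⟩ := hcol y
  intro h
  have := (Finset.sum_eq_zero_iff.1 h) x (Finset.mem_univ _)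
  rcases mul_eq_zero.1 this with h0 | h0
  · exact absurd (ENNReal.ofReal_eq_zero.1 h0) hx.not_ge
  · exact hs z hz x h0

/-- Privacy of a single request made while privacy was ON. -/
lemma law_inter_request_of_private {t : ℕ} {f : Fin (t + 1) → Status}
    [IsFiniteMeasure (c.law π₀ P f)] (hp : c.Private π₀ P f) {i : Fin (t + 1)} (hi : f i = ON)
    (q : Fin (t + 1) → c.Q) (x : Fin 2) :
    c.law π₀ P f (c.pastQueries f ⁻¹' {Fin.init q}) *
        c.law π₀ P f (c.queries f ⁻¹' {q} ∩ {ω | ω.1 i = x}) =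
      c.law π₀ P f (c.queries f ⁻¹' {q}) *
        c.law π₀ P f (c.pastQueries f ⁻¹' {Fin.init q} ∩ {ω | ω.1 i = x}) := by
  have hX : MeasurableSet
      {ω : (Fin (t + 1) → Fin 2) × (Fin (t + 1) → c.S) | ω.1 i = x} :=
    c.measurable_request i (measurableSet_singleton x)
  have h := c.lintegral_of_private hp (Fin.init q) (q (Fin.last t))
    fun u => ({x} : Set (Fin 2)).indicator 1 (u ⟨i, mem_onTimes.2 hi⟩)
  have hind : ∀ E : Set ((Fin (t + 1) → Fin 2) × (Fin (t + 1) → c.S)),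
      ∫⁻ ω in E, ({x} : Set (Fin 2)).indicator 1
        (c.privateRequests f ω ⟨i, mem_onTimes.2 hi⟩) ∂(c.law π₀ P f) =
          c.law π₀ P f (E ∩ {ω | ω.1 i = x}) := by
    intro E
    rw [Set.inter_comm, ← Measure.restrict_apply hX, ← lintegral_indicator_one hX]
    rfl
  rwa [hind, hind, ← queries_preimage] at h

lemma law_inter_request_ne_zero_of_private {t : ℕ} {f : Fin (t + 1) → Status}
    [IsFiniteMeasure (c.law π₀ P f)] (hp : c.Private π₀ P f) {i : Fin (t + 1)} (hi : f i = ON)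
    {q : Fin (t + 1) → c.Q} {x : Fin 2} (hq : c.law π₀ P f (c.queries f ⁻¹' {q}) ≠ 0)
    (hs : c.law π₀ P f (c.pastQueries f ⁻¹' {Fin.init q} ∩ {ω | ω.1 i = x}) ≠ 0) :
    c.law π₀ P f (c.queries f ⁻¹' {q} ∩ {ω | ω.1 i = x}) ≠ 0 := by
  have h := c.law_inter_request_of_private hp hi q x
  exact right_ne_zero_of_mul (h ▸ mul_ne_zero hq hs)

lemma law_pastQueries_ne_zero {t : ℕ} {f : Fin (t + 1) → Status} {q : Fin (t + 1) → c.Q}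
    (hq : c.law π₀ P f (c.queries f ⁻¹' {q}) ≠ 0) :
    c.law π₀ P f (c.pastQueries f ⁻¹' {Fin.init q}) ≠ 0 := by
  rw [queries_preimage] at hq
  exact fun h => hq (measure_mono_null Set.inter_subset_left h)

lemma FullSupport.after {t : ℕ} {f : Fin (t + 1) → Status} [IsFiniteMeasure (c.law π₀ P f)]
    (hs : c.FullSupport π₀ P f) (hp : c.Private π₀ P f) (hf : f (Fin.last t) = ON) :
    c.FullSupportAfter π₀ P f := fun _ hq x =>
  c.law_inter_request_ne_zero_of_private hp hf hq (hs _ (c.law_pastQueries_ne_zero hq) x)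

/-- If each value can be reached with certainty in one step, then each value of the current request
is forced by some value of the initial one. -/
lemma exists_request_zero_of_deterministic (hπ : ∀ x, 0 ≤ π₀ x) (hP : ∀ x y, 0 ≤ P x y)
    (hP1 : ∀ x, ∑ y, P x y = 1) (hdet : ∀ y, ∃ x, ∀ y', y' ≠ y → P x y' = 0) :
    ∀ {t : ℕ} (f : Fin (t + 1) → Status) (y : Fin 2),
      ∃ x, ∀ᵐ z ∂(c.law π₀ P f), z.1 0 = x → z.1 (Fin.last t) = y
  | 0, f, y => ⟨y, Filter.Eventually.of_forall fun _ h => h⟩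
  | t + 1, f, y => by
    obtain ⟨x', hx'⟩ := hdet y
    obtain ⟨x, hx⟩ :=
      exists_request_zero_of_deterministic hπ hP hP1 hdet (Fin.init f : Fin (t + 1) → Status) x'
    refine ⟨x, ?_⟩
    have hE : MeasurableSet {z : (Fin (t + 1) → Fin 2) × (Fin (t + 1) → c.S) |
        z.1 (Fin.last t) = x'} := c.measurable_request _ (measurableSet_singleton x')
    have h0 : MeasurableSet {z : (Fin (t + 1) → Fin 2) × (Fin (t + 1) → c.S) |
        ¬ (z.1 0 = x → z.1 (Fin.last t) = x')} := by
      have : MeasurableSet {z : (Fin (t + 1) → Fin 2) × (Fin (t + 1) → c.S) | z.1 0 = x} :=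
        c.measurable_request _ (measurableSet_singleton x)
      exact (MeasurableSet.imp this hE).compl
    have h1 : ∀ᵐ z ∂(c.law π₀ P f), (forgetLast z).1 0 = x → (forgetLast z).1 (Fin.last t) = x' :=
      (c.law_preimage_forgetLast hπ hP hP1 f h0).trans hx
    have h2 : ∀ᵐ z ∂(c.law π₀ P f), ∀ y', y' ≠ y →
        ¬ ((forgetLast z).1 (Fin.last t) = x' ∧ z.1 (Fin.last (t + 1)) = y') := by
      refine ae_all_iff.2 fun y' => ?_
      by_cases hy : y' = y
      · exact Filter.Eventually.of_forall fun _ h => absurd hy h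
      have h3 := c.law_inter_request hπ hP f hE y'
      rw [Finset.sum_eq_zero, measure_eq_zero_iff_ae_notMem] at h3
      · filter_upwards [h3] with z hz _ using hz
      · intro x'' _
        by_cases hxx : x'' = x'
        · rw [hxx, hx' y' hy, ENNReal.ofReal_zero, zero_mul]
        · have : {z : (Fin (t + 1) → Fin 2) × (Fin (t + 1) → c.S) | z.1 (Fin.last t) = x'} ∩
              {z | z.1 (Fin.last t) = x''} = ∅ := by
            ext z
            simp only [Set.mem_inter_iff, Set.mem_ofPred_eq, Set.mem_empty_iff_false, iff_false]
            rintro ⟨h, h'⟩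
            exact hxx (h'.symm.trans h)
          rw [this, measure_empty, mul_zero]
    filter_upwards [h1, h2] with z hz1 hz2 hz
    by_contra hy
    exact hz2 _ hy ⟨hz1 hz, rfl⟩

/-- The initial request is private forever, so the queries never rule out any of its values. -/
lemma law_inter_request_zero_ne_zero (hπ : ∀ x, 0 < π₀ x) (hπ1 : ∑ x, π₀ x = 1)
    (hP : ∀ x y, 0 ≤ P x y) (hP1 : ∀ x, ∑ y, P x y = 1) {ν : Measure (ℕ → Status)}
    (hν : ∀ᵐ F ∂ν, F 0 = ON)
    (hp : ∀ (t : ℕ) (f : Fin (t + 1) → Status), Possible ν f → c.Private π₀ P f) :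
    ∀ {t : ℕ} {f : Fin (t + 1) → Status}, Possible ν f → ∀ (q : Fin (t + 1) → c.Q),
      c.law π₀ P f (c.queries f ⁻¹' {q}) ≠ 0 → ∀ x,
        c.law π₀ P f (c.queries f ⁻¹' {q} ∩ {ω | ω.1 0 = x}) ≠ 0
  | 0, f, hf, q, hq, x => by
    have := c.isProbabilityMeasure_law (fun x => (hπ x).le) hπ1 hP hP1 f
    exact (c.fullSupport_zero hπ f).after c (hp 0 f hf) (hf.zero_on hν) q hq x
  | t + 1, f, hf, q, hq, x => by
    have := c.isProbabilityMeasure_law (fun x => (hπ x).le) hπ1 hP hP1 f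
    refine c.law_inter_request_ne_zero_of_private (hp _ f hf) (hf.zero_on hν) hq ?_
    have hE : MeasurableSet (c.queries (Fin.init f) ⁻¹' {Fin.init q}) :=
      c.measurable_queries _ (measurableSet_singleton _)
    have hX : MeasurableSet {z : (Fin (t + 1) → Fin 2) × (Fin (t + 1) → c.S) | z.1 0 = x} :=
      c.measurable_request _ (measurableSet_singleton x)
    have h0 := c.law_pastQueries_ne_zero hq
    have hpast : c.pastQueries f ⁻¹' {Fin.init q} =
        forgetLast ⁻¹' (c.queries (Fin.init f) ⁻¹' {Fin.init q}) := rfl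
    rw [hpast, c.law_preimage_forgetLast (fun x => (hπ x).le) hP hP1 f hE] at h0
    have h1 := law_inter_request_zero_ne_zero hπ hπ1 hP hP1 hν hp hf.init (Fin.init q) h0 x
    rwa [← c.law_preimage_forgetLast (fun x => (hπ x).le) hP hP1 f (hE.inter hX)] at h1

lemma fullSupportAfter_of_deterministic (hπ : ∀ x, 0 < π₀ x) (hπ1 : ∑ x, π₀ x = 1)
    (hP : ∀ x y, 0 ≤ P x y) (hP1 : ∀ x, ∑ y, P x y = 1)
    (hdet : ∀ y, ∃ x, ∀ y', y' ≠ y → P x y' = 0) {ν : Measure (ℕ → Status)}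
    (hν : ∀ᵐ F ∂ν, F 0 = ON)
    (hp : ∀ (t : ℕ) (f : Fin (t + 1) → Status), Possible ν f → c.Private π₀ P f)
    {t : ℕ} {f : Fin (t + 1) → Status} (hf : Possible ν f) : c.FullSupportAfter π₀ P f := by
  intro q hq y h
  obtain ⟨x, hx⟩ :=
    c.exists_request_zero_of_deterministic (fun x => (hπ x).le) hP hP1 hdet f y
  refine c.law_inter_request_zero_ne_zero hπ hπ1 hP hP1 hν hp hf q hq x ?_
  rw [measure_eq_zero_iff_ae_notMem] at h ⊢
  filter_upwards [h, hx] with z hz hzx hmem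
  exact hz ⟨hmem.1, hzx hmem.2⟩

/-- Without a switch from OFF to ON, the requests up to the last time when privacy was ON are all
private. -/
lemma fullSupport_of_no_switch (hπ : ∀ x, 0 < π₀ x) (hπ1 : ∑ x, π₀ x = 1)
    (hP : ∀ x y, 0 ≤ P x y) (hP1 : ∀ x, ∑ y, P x y = 1) (hcol : ∀ y, ∃ x, 0 < P x y)
    {ν : Measure (ℕ → Status)}
    (hp : ∀ (t : ℕ) (f : Fin (t + 1) → Status), Possible ν f → c.Private π₀ P f)
    (hno : ∀ (t : ℕ) (f : Fin (t + 1) → Status) (i : Fin t), Possible ν f →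
      f i.succ = ON → f i.castSucc = ON) :
    ∀ {t : ℕ} {f : Fin (t + 1) → Status}, Possible ν f → f (Fin.last t) = ON →
      c.FullSupport π₀ P f
  | 0, f, _, _ => c.fullSupport_zero hπ f
  | t + 1, f, hf, hlast => by
    have := c.isProbabilityMeasure_law (fun x => (hπ x).le) hπ1 hP hP1
      (Fin.init f : Fin (t + 1) → Status)
    have hlast' : (Fin.init f : Fin (t + 1) → Status) (Fin.last t) = ON :=
      hno (t + 1) f (Fin.last t) hf hlast
    have hs := fullSupport_of_no_switch hπ hπ1 hP hP1 hcol hp hno hf.init hlast'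
    exact c.fullSupport_succ (fun x => (hπ x).le) hP hP1 hcol
      (hs.after c (hp _ _ hf.init) hlast')

/-- The densities exist after all histories: they are created anew at each time when privacy is ON
and kept while it is OFF. -/
lemma hasTilts (hπ : ∀ x, 0 ≤ π₀ x) (hπ1 : ∑ x, π₀ x = 1)
    (hP : ∀ x y, 0 ≤ P x y) (hP1 : ∀ x, ∑ y, P x y = 1) {ν : Measure (ℕ → Status)}
    (hν : ∀ᵐ F ∂ν, F 0 = ON)
    (hp : ∀ (t : ℕ) (f : Fin (t + 1) → Status), Possible ν f → c.Private π₀ P f)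
    (hs : ∀ (t : ℕ) (f : Fin (t + 1) → Status), Possible ν f → f (Fin.last t) = ON →
      c.FullSupport π₀ P f) :
    ∀ {t : ℕ} {f : Fin (t + 1) → Status}, Possible ν f → c.HasTilts π₀ P f := by
  intro t
  induction t with
  | zero =>
    intro f hf
    have := c.isProbabilityMeasure_law hπ hπ1 hP hP1 f
    exact c.hasTilts_of_on (hf.zero_on hν) (hp _ f hf) (hs _ f hf (hf.zero_on hν))
  | succ t ih =>
    intro f hf
    have := c.isProbabilityMeasure_law hπ hπ1 hP hP1 f
    cases hlast : f (Fin.last (t + 1)) with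
    | true => exact c.hasTilts_of_on hlast (hp _ f hf) (hs _ f hf hlast)
    | false => exact c.hasTilts_of_off hπ hP hP1 hlast (hp _ f hf) (ih hf.init)

/-! ### The lower bound on the average length -/

/-- The queries that can occur together with the request `y` only. -/
def revealing (π₀ : Fin 2 → ℝ) (P : Matrix (Fin 2) (Fin 2) ℝ) {t : ℕ}
    (f : Fin (t + 1) → Status) (y : Fin 2) : Set c.Q :=
  {q | ∀ y', c.law π₀ P f
    (c.queryAt f (Fin.last t) ⁻¹' {q} ∩ {z | z.1 (Fin.last t) = y'}) ≠ 0 → y' = y}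

lemma ae_law_queryAt_inter_request_ne_zero {t : ℕ} (f : Fin (t + 1) → Status) :
    ∀ᵐ z ∂(c.law π₀ P f), c.law π₀ P f (c.queryAt f (Fin.last t) ⁻¹' {c.queryAt f (Fin.last t) z} ∩
      {z' | z'.1 (Fin.last t) = z.1 (Fin.last t)}) ≠ 0 := by
  filter_upwards [ae_measure_fiber_ne_zero (c.law π₀ P f)
    fun z => (c.queryAt f (Fin.last t) z, z.1 (Fin.last t))] with z hz
  convert hz using 2
  ext z'
  simp

/-- A revealing query is at most as likely as the request that it reveals under each of the tilted
laws. -/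
lemma law_revealing_le {t : ℕ} (f : Fin (t + 1) → Status)
    {h : (Fin (t + 1) → c.Q) → (onTimes f → Fin 2) → ℝ≥0∞}
    (hq : ∀ q, ∫⁻ z in c.queries f ⁻¹' {q}, c.tilt f h z ∂(c.law π₀ P f) =
      c.law π₀ P f (c.queries f ⁻¹' {q})) (y : Fin 2) :
    c.law π₀ P f (c.queryAt f (Fin.last t) ⁻¹' c.revealing π₀ P f y) ≤
      ∫⁻ z in {z | z.1 (Fin.last t) = y}, c.tilt f h z ∂(c.law π₀ P f) := by
  have hX : MeasurableSet
      {ω : (Fin (t + 1) → Fin 2) × (Fin (t + 1) → c.S) | ω.1 (Fin.last t) = y} :=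
    c.measurable_request (Fin.last t) (measurableSet_singleton y)
  have hmap := congrArg (fun m => m {q | q (Fin.last t) ∈ c.revealing π₀ P f y})
    (map_withDensity_eq_map (c.measurable_queries f) hq)
  simp only [Measure.map_apply (c.measurable_queries f) MeasurableSet.of_discrete] at hmap
  refine hmap.symm.le.trans ?_
  rw [← withDensity_apply _ hX]
  refine measure_mono_ae ?_
  filter_upwards [(withDensity_absolutelyContinuous (c.law π₀ P f) (c.tilt f h)).ae_le
    (c.ae_law_queryAt_inter_request_ne_zero f)] with z hz hmem
  exact hmem _ hz

/-- The answer to a query that does not reveal the current request determines both messages. By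
`law_revealing_le`, the queries that reveal `y` have probability at most `min_x p x y`, so the others
have probability at least `1 - ∑ y, min_x p x y = |p 0 0 - p 1 0|`. -/
lemma mul_le_avgLen (hπ : ∀ x, 0 ≤ π₀ x) (hπ1 : ∑ x, π₀ x = 1)
    (hP : ∀ x y, 0 ≤ P x y) (hP1 : ∀ x, ∑ y, P x y = 1) {t : ℕ} {f : Fin (t + 1) → Status}
    (hd : c.Decodable π₀ P f) (ht : c.HasTilts π₀ P f) :
    L * (1 + |P 0 0 - P 1 0| ^ (t - lastOn f)) ≤ c.avgLen π₀ P f := by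
  have := c.isProbabilityMeasure_law hπ hπ1 hP hP1 f
  obtain ⟨h, p, hp0, hp1, hpd, hq, hX⟩ := ht
  have hV : Measurable (c.queryAt f (Fin.last t)) := c.measurable_queryAt f _
  have hm : ∀ y, MeasurableSet (c.queryAt f (Fin.last t) ⁻¹' c.revealing π₀ P f y) := fun y =>
    hV MeasurableSet.of_discrete
  have hle : ∀ x y,
      (c.law π₀ P f).real (c.queryAt f (Fin.last t) ⁻¹' c.revealing π₀ P f y) ≤ p x y := by
    intro x y
    have := (c.law_revealing_le f (hq x) y).trans_eq (hX x y)
    exact ENNReal.toReal_le_of_le_ofReal (hp0 x y) this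
  have hmono : ∫ z, (L : ℝ) * (2 -
      ((c.queryAt f (Fin.last t) ⁻¹' c.revealing π₀ P f 0).indicator 1 z +
        (c.queryAt f (Fin.last t) ⁻¹' c.revealing π₀ P f 1).indicator 1 z)) ∂(c.law π₀ P f) ≤
      c.avgLen π₀ P f := by
    refine integral_mono_ae ?_ ?_ ?_
    · exact (((integrable_const _).sub (((integrable_const _).indicator (hm 0)).add
        ((integrable_const _).indicator (hm 1)))).const_mul _)
    · refine Integrable.of_bound (C := ((2 * L : ℕ) : ℝ)) ?_
        (Filter.Eventually.of_forall fun z => ?_)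
      · exact ((Measurable.of_discrete (f := fun q => (c.len q : ℝ))).comp hV).aestronglyMeasurable
      · rw [Real.norm_natCast]
        exact_mod_cast c.len_le _
    · filter_upwards [c.ae_law_queryAt_inter_request_ne_zero f] with z hz
      have hL : (L : ℝ) ≤ c.len (c.queryAt f (Fin.last t) z) := by
        exact_mod_cast c.le_len_of_decoder (c.exists_decoder hd hz)
      by_cases h0 : z ∈ c.queryAt f (Fin.last t) ⁻¹' c.revealing π₀ P f 0
      · rw [Set.indicator_of_mem h0]
        have : (0 : ℝ) ≤
            (c.queryAt f (Fin.last t) ⁻¹' c.revealing π₀ P f 1).indicator 1 z :=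
          Set.indicator_nonneg (fun _ _ => zero_le_one) _
        have hL0 : (0 : ℝ) ≤ L := L.cast_nonneg
        rw [Pi.one_apply]
        nlinarith
      by_cases h1 : z ∈ c.queryAt f (Fin.last t) ⁻¹' c.revealing π₀ P f 1
      · rw [Set.indicator_of_mem h1, Set.indicator_of_notMem h0, Pi.one_apply]
        linarith
      rw [Set.indicator_of_notMem h0, Set.indicator_of_notMem h1, add_zero, sub_zero]
      have hboth : ∀ y, c.law π₀ P f (c.queryAt f (Fin.last t) ⁻¹'
          {c.queryAt f (Fin.last t) z} ∩ {z' | z'.1 (Fin.last t) = y}) ≠ 0 := by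
        intro y hy
        fin_cases y
        · refine h1 fun y' hy' => ?_
          fin_cases y'
          · exact absurd hy hy'
          · rfl
        · refine h0 fun y' hy' => ?_
          fin_cases y'
          · rfl
          · exact absurd hy hy'
      exact_mod_cast c.two_mul_le_len_of_decoders fun y => c.exists_decoder hd (hboth y)
  refine le_trans ?_ hmono
  rw [integral_const_mul, integral_sub (integrable_const _)
    (((integrable_const _).indicator (hm 0)).add ((integrable_const _).indicator (hm 1))),
    integral_add ((integrable_const _).indicator (hm 0)) ((integrable_const _).indicator (hm 1)),
    integral_indicator_one (hm 0), integral_indicator_one (hm 1), integral_const]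
  simp only [probReal_univ, one_smul]
  refine mul_le_mul_of_nonneg_left ?_ L.cast_nonneg
  rw [← abs_pow, ← hpd]
  have h00 := hle 0 0
  have h10 := hle 1 0
  have h01 := hle 0 1
  have h11 := hle 1 1
  have hs0 := hp1 0
  have hs1 := hp1 1
  rcases abs_cases (p 0 0 - p 1 0) with ⟨ha, _⟩ | ⟨ha, _⟩ <;> rw [ha] <;> linarith

end Code

/-- Converse. In each of the three cases of `hreg`, the past queries leave both values of the request
possible at the times when privacy is ON. -/
lemma one_add_le_of_achievable {π₀ : Fin 2 → ℝ} {P : Matrix (Fin 2) (Fin 2) ℝ}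
    (hπ : ∀ x, 0 < π₀ x) (hπ1 : ∑ x, π₀ x = 1)
    (hP : ∀ x y, 0 ≤ P x y) (hP1 : ∀ x, ∑ y, P x y = 1) (hcol : ∀ y, ∃ x, 0 < P x y)
    {ν : Measure (ℕ → Status)} (hν : ∀ᵐ F ∂ν, F 0 = ON)
    (hreg : (∀ x y, 0 < P x y) ∨ (∀ y, ∃ x, ∀ y', y' ≠ y → P x y' = 0) ∨
      ∀ (t : ℕ) (f : Fin (t + 1) → Status) (i : Fin t), Possible ν f →
        f i.succ = ON → f i.castSucc = ON)
    {R : (t : ℕ) → (Fin (t + 1) → Status) → ℝ}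
    (hR : ∀ (t : ℕ) (f : Fin (t + 1) → Status), Possible ν f → 0 < R t f)
    (h : Achievable π₀ P ν R) (t : ℕ) (f : Fin (t + 1) → Status) (hf : Possible ν f) :
    1 / R t f ≥ 1 + |P 0 0 - P 1 0| ^ (t - lastOn f) := by
  obtain ⟨L, hL, c, hc⟩ := h
  have hp : ∀ (t : ℕ) (f : Fin (t + 1) → Status), Possible ν f → c.Private π₀ P f :=
    fun t f hf => (hc t f hf).2.1
  have hπ0 : ∀ x, 0 ≤ π₀ x := fun x => (hπ x).le
  have hs : ∀ (t : ℕ) (f : Fin (t + 1) → Status), Possible ν f → f (Fin.last t) = ON →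
      c.FullSupport π₀ P f := by
    intro t f hf hlast
    rcases hreg with hpos | hdet | hno
    · cases t with
      | zero => exact c.fullSupport_zero hπ f
      | succ t => exact c.fullSupport_succ_of_pos hπ0 hpos hP1 f
    · cases t with
      | zero => exact c.fullSupport_zero hπ f
      | succ t =>
        exact c.fullSupport_succ hπ0 hP hP1 hcol
          (c.fullSupportAfter_of_deterministic hπ hπ1 hP hP1 hdet hν hp hf.init)
    · exact c.fullSupport_of_no_switch hπ hπ1 hP hP1 hcol hp hno hf hlast
  obtain ⟨hd, -, hrate⟩ := hc t f hf
  have hlen := c.mul_le_avgLen hπ0 hπ1 hP hP1 hd (c.hasTilts hπ0 hπ1 hP hP1 hν hp hs hf)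
  have hL0 : (0 : ℝ) < L := Nat.cast_pos.2 hL
  have hb : 0 < 1 + |P 0 0 - P 1 0| ^ (t - lastOn f) := by positivity
  have havg : 0 < c.avgLen π₀ P f := (mul_pos hL0 hb).trans_le hlen
  have hRp := hR t f hf
  rw [le_div_iff₀ havg] at hrate
  rw [ge_iff_le, le_div_iff₀ hRp]
  have h1 := mul_le_mul_of_nonneg_left hlen hRp.le
  have h2 : (L : ℝ) * ((1 + |P 0 0 - P 1 0| ^ (t - lastOn f)) * R t f) ≤ L * 1 := by linarith
  exact le_of_mul_le_mul_left h2 hL0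

end OnOffPrivacy

theorem theorem3 (α β : ℝ) (hα : 0 ≤ α ∧ α ≤ 1) (hβ : 0 ≤ β ∧ β ≤ 1)
    (π₀ : Fin 2 → ℝ) (hπ₀ : π₀ ∈ stdSimplex ℝ (Fin 2))
    (ν : Measure (ℕ → OnOffPrivacy.Status)) [IsProbabilityMeasure ν]
    (hν : ∀ᵐ F ∂ν, F 0 = OnOffPrivacy.ON)
    (R : (t : ℕ) → (Fin (t + 1) → OnOffPrivacy.Status) → ℝ)
    (hR : ∀ (t : ℕ) (f : Fin (t + 1) → OnOffPrivacy.Status),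
      OnOffPrivacy.Possible ν f → 0 < R t f) :
    ((∀ x, 0 < π₀ x) → ¬(α = 1 ∧ β = 0) → ¬(α = 0 ∧ β = 1) →
      ((∃ (t : ℕ) (f : Fin (t + 1) → OnOffPrivacy.Status) (i : Fin t),
          OnOffPrivacy.Possible ν f ∧
            f i.castSucc = OnOffPrivacy.OFF ∧ f i.succ = OnOffPrivacy.ON) →
        ((0 < α ∧ α < 1) ∧ (0 < β ∧ β < 1)) ∨ (α = 0 ∧ β = 0) ∨ (α = 1 ∧ β = 1)) →
      (OnOffPrivacy.Achievable π₀ !![1 - α, α; β, 1 - β] ν R ↔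
        ∀ (t : ℕ) (f : Fin (t + 1) → OnOffPrivacy.Status), OnOffPrivacy.Possible ν f →
          1 / R t f ≥ 1 + |1 - α - β| ^ (t - OnOffPrivacy.lastOn f))) ∧
    ((∀ (t : ℕ) (f : Fin (t + 1) → OnOffPrivacy.Status), OnOffPrivacy.Possible ν f →
        1 / R t f ≥ 1 + |1 - α - β| ^ (t - OnOffPrivacy.lastOn f)) →
      OnOffPrivacy.Achievable π₀ !![1 - α, α; β, 1 - β] ν R) := by
  have hP : ∀ x y, 0 ≤ (!![1 - α, α; β, 1 - β] : Matrix (Fin 2) (Fin 2) ℝ) x y := by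
    intro x y
    fin_cases x <;> fin_cases y <;> simp [hα, hβ]
  have hP1 : ∀ x, ∑ y, (!![1 - α, α; β, 1 - β] : Matrix (Fin 2) (Fin 2) ℝ) x y = 1 := by
    intro x
    fin_cases x <;> simp
  have hachieve := OnOffPrivacy.achievable_of_le hπ₀.1 hπ₀.2 hP hP1 hν hR
  have hlam : (!![1 - α, α; β, 1 - β] : Matrix (Fin 2) (Fin 2) ℝ) 0 0 -
      (!![1 - α, α; β, 1 - β] : Matrix (Fin 2) (Fin 2) ℝ) 1 0 = 1 - α - β := by simp
  rw [hlam] at hachieve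
  refine ⟨fun hπ hne1 hne2 hswitch => ⟨fun h t f hf => ?_, hachieve⟩, hachieve⟩
  have hcol : ∀ y, ∃ x, 0 < (!![1 - α, α; β, 1 - β] : Matrix (Fin 2) (Fin 2) ℝ) x y := by
    intro y
    by_contra! hy
    fin_cases y
    · have h0 := hy 0
      have h1 := hy 1
      simp at h0 h1
      exact hne1 ⟨by linarith, by linarith⟩
    · have h0 := hy 0
      have h1 := hy 1
      simp at h0 h1
      exact hne2 ⟨by linarith, by linarith⟩
  rw [← hlam]
  refine OnOffPrivacy.one_add_le_of_achievable hπ hπ₀.2 hP hP1 hcol hν ?_ hR h t f hf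
  by_cases hsw : ∃ (t : ℕ) (f : Fin (t + 1) → OnOffPrivacy.Status) (i : Fin t),
      OnOffPrivacy.Possible ν f ∧ f i.castSucc = OnOffPrivacy.OFF ∧ f i.succ = OnOffPrivacy.ON
  · rcases hswitch hsw with hpos | ⟨rfl, rfl⟩ | ⟨rfl, rfl⟩
    · refine Or.inl fun x y => ?_
      fin_cases x <;> fin_cases y <;> simp [hpos]
    · refine Or.inr (Or.inl fun y => ⟨y, fun y' hy => ?_⟩)
      fin_cases y <;> fin_cases y' <;> simp at hy ⊢
    · refine Or.inr (Or.inl fun y => ⟨y + 1, fun y' hy => ?_⟩)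
      fin_cases y <;> fin_cases y' <;> simp at hy ⊢
  · refine Or.inr (Or.inr fun t f i hf hi => ?_)
    by_contra hoff
    exact hsw ⟨t, f, i, hf, by simpa using hoff, hi⟩
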